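/- Let $\mathbb K\in\{\mathbb R,\mathbb C\}$, let $\Omega\subset\mathbb R^n$ be open, and let $(\Omega_m)_{m\in\mathbb N}$ be an exhaustion of $\Omega$ by an increasing sequence of open sets with $\overline{\Omega_m}\subset\Omega$ compact. Let $\mathcal G(\Omega)=\mathcal E_M(\Omega)/\mathcal N(\Omega)$ be the (special) Colombeau algebra: $\mathcal E_M(\Omega)$ is the algebra of nets $(u_\varepsilon)_{\varepsilon\in]0,1]}$ in $C^\infty(\Omega)=C^\infty(\Omega,\mathbb K)$ such that for every compact $K\subset\Omega$ and every $\beta\in\mathbb N^n$ there is $N$ with $\sup_K|\partial^\beta u_\varepsilon|=O(\varepsilon^{-N})$ as $\varepsilon\to0$, and $\mathcal N(\Omega)$ is the ideal of the nets for which this holds with $\varepsilon^{q}$ for every $q\in\mathbb N$ in place of $\varepsilon^{-N}$. For $f,g\in\mathcal G(\Omega)$ and $m,p\in\mathbb N$ put $$V_{mp}(f)=\sup\{a\in\mathbb R:\ \sup_{\Omega_m}|\partial^\beta f_\varepsilon|=o(\varepsilon^a)\ (\varepsilon\to0)\ \text{for all } |\beta|\le p\},\qquad D_{mp}(f,g)=e^{-V_{mp}(f-g)},$$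 where $(f_\varepsilon)$ is any representative of $f$ (and $e^{-\infty}=0$), and let $$D(f,g)=\sup_{m\in\mathbb N}\frac{2D_{mm}(f,g)}{1+D_{mm}(f,g)},\qquad \|f\|=D(f,0).$$ $D$ is an ultrametric on $\mathcal G(\Omega)$; consider on $\mathcal G(\Omega)$ the topology generated by its open balls. 1. Let $\rho\in\mathcal S(\mathbb R^n)$ be a real-valued mollifier, i.e. $\int\rho=1$ and $\int x^\beta\rho(x)\,dx=0$ for all $\beta\ne0$, and put $\rho_\varepsilon(x)=\varepsilon^{-n}\rho(x/\varepsilon)$. There is exactly one map $\iota:\mathcal D'(\Omega)\to\mathcal G(\Omega)$ (the canonical embedding belonging to $\rho$) such that for every distribution $T\in\mathcal D'(\Omega)$, every open set $W$ whose closure is a compact subset of $\Omega$, and every $\psi\in\mathcal D(\Omega)$ equal to $1$ in a neighbourhood of $\overline W$, the restriction of $\iota(T)$ to $W$ is the class of the net of smooth functions $\big((\psi T)*\rho_\varepsilon\big)|_W$. The map $\iota$ is $\mathbb K$-linear and injective, and its image is a discrete subset of $\mathcal G(\Omega)$, i.e. the topology induced on $\iota(\mathcal D'(\Omega))$ is the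 discrete one. 2. For every invertible element $h$ of the ring $C^\infty(\Omega)$ (regarded in $\mathcal G(\Omega)$ as the class of the constant net $h$) and every $f\in\mathcal G(\Omega)$ one has $\|hf\|=\|f\|$. -/

import Mathlib

open scoped ContDiff Distributions Topology

namespace Colombeau

noncomputable section

/-- The index set `]0, 1]` of all nets. -/
abbrev I : Type := Set.Ioc (0 : ℝ) 1

/-- Extension by zero of a function on the open set `Ω`. It only serves to speak about the
derivatives of the function at the points of `Ω`. -/
def ext {n : ℕ} {𝕜 : Type*} [RCLike 𝕜] {Ω : TopologicalSpace.Opens (EuclideanSpace ℝ (Fin n))}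
    (f : Ω → 𝕜) (x : EuclideanSpace ℝ (Fin n)) : 𝕜 :=
  open scoped Classical in if h : x ∈ Ω then f ⟨x, h⟩ else 0

/-- The net `v` satisfies: all derivatives of order `≤ p` of `v ε` are `O(ε ^ a)` as `ε → 0`,
uniformly on `K`. The operator norm of the `k`-th Fréchet derivative is equivalent to the maximum
of the absolute values of the partial derivatives of order `k`. -/
def IsBigOn {n : ℕ} {𝕜 : Type*} [RCLike 𝕜] (v : I → EuclideanSpace ℝ (Fin n) → 𝕜)
    (K : Set (EuclideanSpace ℝ (Fin n))) (p : ℕ) (a : ℝ) : Prop :=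
  ∃ C η : ℝ, 0 < η ∧ ∀ ε : I, (ε : ℝ) ≤ η → ∀ k ≤ p, ∀ x ∈ K,
    ‖iteratedFDeriv ℝ k (v ε) x‖ ≤ C * (ε : ℝ) ^ a

/-- The net `v` satisfies: all derivatives of order `≤ p` of `v ε` are `o(ε ^ a)` as `ε → 0`,
uniformly on `K`. -/
def IsLittleOn {n : ℕ} {𝕜 : Type*} [RCLike 𝕜] (v : I → EuclideanSpace ℝ (Fin n) → 𝕜)
    (K : Set (EuclideanSpace ℝ (Fin n))) (p : ℕ) (a : ℝ) : Prop :=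
  ∀ c : ℝ, 0 < c → ∃ η : ℝ, 0 < η ∧ ∀ ε : I, (ε : ℝ) ≤ η → ∀ k ≤ p, ∀ x ∈ K,
    ‖iteratedFDeriv ℝ k (v ε) x‖ ≤ c * (ε : ℝ) ^ a

/-- Moderateness on the open set `U`. -/
def IsModerateOn {n : ℕ} {𝕜 : Type*} [RCLike 𝕜] (v : I → EuclideanSpace ℝ (Fin n) → 𝕜)
    (U : Set (EuclideanSpace ℝ (Fin n))) : Prop :=
  ∀ K ⊆ U, IsCompact K → ∀ p : ℕ, ∃ N : ℕ, IsBigOn v K p (-(N : ℝ))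

/-- Negligibility on the open set `U`. -/
def IsNegligibleOn {n : ℕ} {𝕜 : Type*} [RCLike 𝕜] (v : I → EuclideanSpace ℝ (Fin n) → 𝕜)
    (U : Set (EuclideanSpace ℝ (Fin n))) : Prop :=
  ∀ K ⊆ U, IsCompact K → ∀ p q : ℕ, IsBigOn v K p (q : ℝ)

section aux

variable {n : ℕ} {𝕜 : Type*} [RCLike 𝕜] {Ω : TopologicalSpace.Opens (EuclideanSpace ℝ (Fin n))}

lemma ext_of_mem (f : Ω → 𝕜) {x : EuclideanSpace ℝ (Fin n)} (h : x ∈ Ω) :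
    ext f x = f ⟨x, h⟩ := by simp [ext, h]

lemma ext_add (f g : Ω → 𝕜) : ext (f + g) = fun x => ext f x + ext g x := by
  funext x; by_cases h : x ∈ Ω <;> simp [ext, h]

lemma ext_mul (f g : Ω → 𝕜) : ext (f * g) = fun x => ext f x * ext g x := by
  funext x; by_cases h : x ∈ Ω <;> simp [ext, h]

end aux

/-- The algebra `C^∞(Ω)` of smooth `𝕜`-valued functions on `Ω`. -/
def smooth (𝕜 : Type*) [RCLike 𝕜] {n : ℕ} (Ω : TopologicalSpace.Opens (EuclideanSpace ℝ (Fin n))) :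
    Subalgebra 𝕜 (Ω → 𝕜) where
  carrier := {f | ContDiffOn ℝ ∞ (ext f) Ω}
  add_mem' := by
    intro f g hf hg
    simp only [Set.mem_ofPred_eq, ext_add] at *
    exact hf.add hg
  mul_mem' := by
    intro f g hf hg
    simp only [Set.mem_ofPred_eq, ext_mul] at *
    exact hf.mul hg
  algebraMap_mem' := by
    intro c
    refine (contDiffOn_const (c := c)).congr fun x hx => ?_
    rw [ext_of_mem _ hx]; rfl

section aux

variable {n : ℕ} {𝕜 : Type*} [RCLike 𝕜] {Ω : TopologicalSpace.Opens (EuclideanSpace ℝ (Fin n))}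

lemma smooth_contDiffAt (f : smooth 𝕜 Ω) {x : EuclideanSpace ℝ (Fin n)} (hx : x ∈ Ω) (k : ℕ) :
    ContDiffAt ℝ k (ext (f : Ω → 𝕜)) x :=
  ((f.2 : ContDiffOn ℝ ∞ (ext (f : Ω → 𝕜)) Ω).contDiffAt (Ω.isOpen.mem_nhds hx)).of_le
    (by exact_mod_cast le_top)

/-- Extension by zero, index by index, of a net of smooth functions. -/
def extNet (u : I → smooth 𝕜 Ω) (ε : I) : EuclideanSpace ℝ (Fin n) → 𝕜 := ext (u ε : Ω → 𝕜)

lemma IsBigOn.mono {v : I → EuclideanSpace ℝ (Fin n) → 𝕜} {K : Set (EuclideanSpace ℝ (Fin n))}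
    {p : ℕ} {a b : ℝ} (h : IsBigOn v K p a) (hab : b ≤ a) : IsBigOn v K p b := by
  obtain ⟨C, η, hη, h⟩ := h
  refine ⟨|C|, η, hη, fun ε hε k hk x hx => (h ε hε k hk x hx).trans ?_⟩
  have h1 : (ε : ℝ) ^ a ≤ (ε : ℝ) ^ b := Real.rpow_le_rpow_of_exponent_ge ε.2.1 ε.2.2 hab
  have h2 : 0 ≤ (ε : ℝ) ^ a := Real.rpow_nonneg ε.2.1.le _
  exact mul_le_mul (le_abs_self C) h1 h2 (abs_nonneg C)

lemma isBigOn_add {u v : I → smooth 𝕜 Ω} {K : Set (EuclideanSpace ℝ (Fin n))} (hK : K ⊆ Ω)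
    {p : ℕ} {a : ℝ} (hu : IsBigOn (extNet u) K p a) (hv : IsBigOn (extNet v) K p a) :
    IsBigOn (extNet (u + v)) K p a := by
  obtain ⟨C, η, hη, h⟩ := hu
  obtain ⟨C', η', hη', h'⟩ := hv
  refine ⟨C + C', min η η', lt_min hη hη', fun ε hε k hk x hx => ?_⟩
  have e : extNet (u + v) ε = ext (u ε : Ω → 𝕜) + ext (v ε : Ω → 𝕜) := ext_add _ _
  rw [e, iteratedFDeriv_add_apply (smooth_contDiffAt _ (hK hx) k) (smooth_contDiffAt _ (hK hx) k)]
  refine (norm_add_le _ _).trans ?_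
  rw [add_mul]
  exact add_le_add (h ε (hε.trans (min_le_left _ _)) k hk x hx)
    (h' ε (hε.trans (min_le_right _ _)) k hk x hx)

lemma isBigOn_mul {u v : I → smooth 𝕜 Ω} {K : Set (EuclideanSpace ℝ (Fin n))} (hK : K ⊆ Ω)
    {p : ℕ} {a b : ℝ} (hu : IsBigOn (extNet u) K p a) (hv : IsBigOn (extNet v) K p b) :
    IsBigOn (extNet (u * v)) K p (a + b) := by
  obtain ⟨C, η, hη, h⟩ := hu
  obtain ⟨C', η', hη', h'⟩ := hv
  refine ⟨2 ^ p * (|C| * |C'|), min η η', lt_min hη hη', fun ε hε k hk x hx => ?_⟩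
  have e : extNet (u * v) ε = fun y => ext (u ε : Ω → 𝕜) y * ext (v ε : Ω → 𝕜) y := ext_mul _ _
  have hpos : (0 : ℝ) < ε := ε.2.1
  have key := norm_iteratedFDerivWithin_mul_le (u ε).2 (v ε).2 Ω.isOpen.uniqueDiffOn (hK hx)
    (n := k) (by exact_mod_cast le_top)
  rw [e, ← iteratedFDerivWithin_of_isOpen k Ω.isOpen (hK hx), Real.rpow_add hpos]
  refine key.trans ?_
  calc _ ≤ ∑ i ∈ Finset.range (k + 1), (k.choose i : ℝ) *
        ((|C| * (ε : ℝ) ^ a) * (|C'| * (ε : ℝ) ^ b)) := by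
        refine Finset.sum_le_sum fun i hi => ?_
        rw [mul_assoc]
        refine mul_le_mul_of_nonneg_left ?_ (Nat.cast_nonneg _)
        have hik : i ≤ p := (Nat.lt_succ_iff.1 (Finset.mem_range.1 hi)).trans hk
        rw [iteratedFDerivWithin_of_isOpen _ Ω.isOpen (hK hx),
          iteratedFDerivWithin_of_isOpen _ Ω.isOpen (hK hx)]
        refine mul_le_mul ?_ ?_ (norm_nonneg _) (by positivity)
        · exact (h ε (hε.trans (min_le_left _ _)) i hik x hx).trans
            (mul_le_mul_of_nonneg_right (le_abs_self _) (by positivity))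
        · exact (h' ε (hε.trans (min_le_right _ _)) (k - i) ((Nat.sub_le _ _).trans hk) x hx).trans
            (mul_le_mul_of_nonneg_right (le_abs_self _) (by positivity))
    _ = 2 ^ k * ((|C| * (ε : ℝ) ^ a) * (|C'| * (ε : ℝ) ^ b)) := by
        rw [← Finset.sum_mul]; congr 1; exact_mod_cast Nat.sum_range_choose k
    _ ≤ 2 ^ p * ((|C| * (ε : ℝ) ^ a) * (|C'| * (ε : ℝ) ^ b)) := by
        refine mul_le_mul_of_nonneg_right ?_ (by positivity)
        exact pow_le_pow_right₀ (by norm_num) hk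
    _ = _ := by ring

/-- Constant nets are bounded, with all their derivatives, on compact subsets of `Ω`. -/
lemma isBigOn_const (f : smooth 𝕜 Ω) {K : Set (EuclideanSpace ℝ (Fin n))} (hK : K ⊆ Ω)
    (hc : IsCompact K) (p : ℕ) : IsBigOn (extNet fun _ => f) K p 0 := by
  have hb : ∀ k : ℕ, ∃ C : ℝ, ∀ x ∈ K, ‖iteratedFDeriv ℝ k (ext (f : Ω → 𝕜)) x‖ ≤ C := by
    intro k
    refine hc.exists_bound_of_continuousOn ?_
    have h1 : ContinuousOn (iteratedFDerivWithin ℝ k (ext (f : Ω → 𝕜)) Ω) Ω :=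
      ContDiffOn.continuousOn_iteratedFDerivWithin (n := ∞) f.2 (by exact_mod_cast le_top)
        Ω.isOpen.uniqueDiffOn
    exact (h1.congr fun x hx => (iteratedFDerivWithin_of_isOpen k Ω.isOpen hx).symm).mono hK
  choose C hC using hb
  refine ⟨∑ k ∈ Finset.range (p + 1), |C k|, 1, one_pos, fun ε _ k hk x hx => ?_⟩
  rw [Real.rpow_zero, mul_one]
  refine ((hC k x hx).trans (le_abs_self _)).trans ?_
  exact Finset.single_le_sum (f := fun k => |C k|) (fun _ _ => abs_nonneg _)
    (Finset.mem_range.2 (Nat.lt_succ_iff.2 hk))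

end aux

/-- The algebra `ℰ_M(Ω)` of moderate nets of smooth functions on `Ω`. -/
def moderate (𝕜 : Type*) [RCLike 𝕜] {n : ℕ}
    (Ω : TopologicalSpace.Opens (EuclideanSpace ℝ (Fin n))) :
    Subalgebra 𝕜 (I → smooth 𝕜 Ω) where
  carrier := {u | IsModerateOn (extNet u) Ω}
  add_mem' := by
    intro u v hu hv K hK hc p
    obtain ⟨N, hN⟩ := hu K hK hc p
    obtain ⟨M, hM⟩ := hv K hK hc p
    refine ⟨N + M, isBigOn_add hK (hN.mono ?_) (hM.mono ?_)⟩ <;> push_cast <;>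
      linarith [Nat.cast_nonneg (α := ℝ) N, Nat.cast_nonneg (α := ℝ) M]
  mul_mem' := by
    intro u v hu hv K hK hc p
    obtain ⟨N, hN⟩ := hu K hK hc p
    obtain ⟨M, hM⟩ := hv K hK hc p
    refine ⟨N + M, (isBigOn_mul hK hN hM).mono ?_⟩
    push_cast
    linarith
  algebraMap_mem' := by
    intro c K hK hc p
    refine ⟨0, ?_⟩
    have h := isBigOn_const (algebraMap 𝕜 (smooth 𝕜 Ω) c) hK hc p
    rw [Nat.cast_zero, neg_zero]
    exact h

instance instCommRingModerate (𝕜 : Type*) [RCLike 𝕜] {n : ℕ}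
    (Ω : TopologicalSpace.Opens (EuclideanSpace ℝ (Fin n))) : CommRing (moderate 𝕜 Ω) :=
  Subalgebra.toCommRing (moderate 𝕜 Ω)

/-- The ideal `𝒩(Ω)` of negligible nets. -/
def negligible (𝕜 : Type*) [RCLike 𝕜] {n : ℕ}
    (Ω : TopologicalSpace.Opens (EuclideanSpace ℝ (Fin n))) : Ideal (moderate 𝕜 Ω) where
  carrier := {u | IsNegligibleOn (extNet (u : I → smooth 𝕜 Ω)) Ω}
  add_mem' := by
    intro u v hu hv K hK hc p q
    exact isBigOn_add hK (hu K hK hc p q) (hv K hK hc p q)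
  zero_mem' := by
    intro K hK hc p q
    refine ⟨0, 1, one_pos, fun ε _ k _ x _ => ?_⟩
    have e : extNet (0 : I → smooth 𝕜 Ω) ε = 0 := by
      funext y; by_cases h : y ∈ Ω <;> simp [extNet, ext, h]
    simp [e]
  smul_mem' := by
    intro u v hv K hK hc p q
    obtain ⟨N, hN⟩ := u.2 K hK hc p
    refine (isBigOn_mul hK hN (hv K hK hc p (N + q))).mono ?_
    push_cast
    linarith

/-- The (special) Colombeau algebra `𝒢(Ω) = ℰ_M(Ω) / 𝒩(Ω)`. -/
def Gen (𝕜 : Type*) [RCLike 𝕜] {n : ℕ}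
    (Ω : TopologicalSpace.Opens (EuclideanSpace ℝ (Fin n))) : Type _ :=
  moderate 𝕜 Ω ⧸ negligible 𝕜 Ω

instance instCommRingGen (𝕜 : Type*) [RCLike 𝕜] {n : ℕ}
    (Ω : TopologicalSpace.Opens (EuclideanSpace ℝ (Fin n))) : CommRing (Gen 𝕜 Ω) :=
  Ideal.Quotient.commRing (negligible 𝕜 Ω)

instance instAlgebraGen (𝕜 : Type*) [RCLike 𝕜] {n : ℕ}
    (Ω : TopologicalSpace.Opens (EuclideanSpace ℝ (Fin n))) : Algebra 𝕜 (Gen 𝕜 Ω) :=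
  Ideal.Quotient.algebra 𝕜 (I := negligible 𝕜 Ω)

/-- The class in `𝒢(Ω)` of a moderate net. -/
def mk {𝕜 : Type*} [RCLike 𝕜] {n : ℕ}
    {Ω : TopologicalSpace.Opens (EuclideanSpace ℝ (Fin n))} : moderate 𝕜 Ω →ₐ[𝕜] Gen 𝕜 Ω :=
  Ideal.Quotient.mkₐ 𝕜 (negligible 𝕜 Ω)

/-- The diagonal embedding `C^∞(Ω) → 𝒢(Ω)`, sending `h` to the class of the constant net `h`. -/
def diag (𝕜 : Type*) [RCLike 𝕜] {n : ℕ}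
    (Ω : TopologicalSpace.Opens (EuclideanSpace ℝ (Fin n))) : smooth 𝕜 Ω →+* Gen 𝕜 Ω :=
  (mk : moderate 𝕜 Ω →ₐ[𝕜] Gen 𝕜 Ω).toRingHom.comp
    { toFun := fun h => ⟨fun _ => h, fun K hK hc p => ⟨0, by
        simpa using isBigOn_const h hK hc p⟩⟩
      map_one' := rfl
      map_mul' := fun _ _ => rfl
      map_zero' := rfl
      map_add' := fun _ _ => rfl }

/-- An exhaustion of `Ω` by an increasing sequence of open sets that are relatively compact
in `Ω`. -/
structure Exhaustion {n : ℕ} (Ω : TopologicalSpace.Opens (EuclideanSpace ℝ (Fin n))) where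
  /-- The sets of the exhaustion. -/
  set : ℕ → Set (EuclideanSpace ℝ (Fin n))
  isOpen : ∀ m, IsOpen (set m)
  isCompact_closure : ∀ m, IsCompact (closure (set m))
  closure_subset : ∀ m, closure (set m) ⊆ Ω
  mono : Monotone set
  iUnion_eq : ⋃ m, set m = Ω

section metric

variable {n : ℕ} {𝕜 : Type*} [RCLike 𝕜] {Ω : TopologicalSpace.Opens (EuclideanSpace ℝ (Fin n))}

/-- `V_{mp}(f) ∈ [-∞, ∞]`: the supremum of all real `a` such that the derivatives of order `≤ p` of
a representative of `f` are `o(ε ^ a)` uniformly on the `m`-th set of the exhaustion. (The choice of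
the representative does not matter.) -/
def V (X : Exhaustion Ω) (m p : ℕ) (f : Gen 𝕜 Ω) : EReal :=
  sSup {b : EReal | ∃ a : ℝ, b = a ∧ ∃ u : moderate 𝕜 Ω, mk u = f ∧
    IsLittleOn (extNet (u : I → smooth 𝕜 Ω)) (X.set m) p a}

/-- `D_{mp}(f, g) = exp (-V_{mp}(f - g))`, with `exp (-∞) = 0`; the value of `V_{mp}` is never `-∞`,
because the nets are moderate. -/
def Dmp (X : Exhaustion Ω) (m p : ℕ) (f g : Gen 𝕜 Ω) : ℝ :=
  (EReal.exp (-V X m p (f - g))).toReal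

/-- The ultrametric `D(f, g) = sup_m 2 D_{mm}(f, g) / (1 + D_{mm}(f, g))` of `𝒢(Ω)`. -/
def D (X : Exhaustion Ω) (f g : Gen 𝕜 Ω) : ℝ :=
  ⨆ m : ℕ, 2 * Dmp X m m f g / (1 + Dmp X m m f g)

/-- `‖f‖ = D(f, 0)`. -/
def gnorm (X : Exhaustion Ω) (f : Gen 𝕜 Ω) : ℝ := D X f 0

variable (𝕜) in
/-- The topology of `𝒢(Ω)` generated by the open balls of the ultrametric `D`. -/
@[reducible]
def sharpTopology (X : Exhaustion Ω) : TopologicalSpace (Gen 𝕜 Ω) :=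
  TopologicalSpace.generateFrom {s | ∃ (f : Gen 𝕜 Ω) (r : ℝ), s = {g | D X g f < r}}

end metric

/-- `ρ` is a mollifier: a Schwartz function with integral one, all of whose higher moments
vanish. -/
def IsMollifier {n : ℕ} (ρ : SchwartzMap (EuclideanSpace ℝ (Fin n)) ℝ) : Prop :=
  ∫ x, ρ x = 1 ∧ ∀ β : Fin n → ℕ, β ≠ 0 → ∫ x, (∏ i, x i ^ β i) * ρ x = 0

/-- The test function `y ↦ ψ(y) ρ_ε(x - y)`, where `ρ_ε(z) = ε⁻ⁿ ρ(z / ε)`. -/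
def kernel {n : ℕ} {Ω : TopologicalSpace.Opens (EuclideanSpace ℝ (Fin n))} (ψ : 𝓓(Ω, ℝ))
    (ρ : SchwartzMap (EuclideanSpace ℝ (Fin n)) ℝ) (ε : ℝ) (x : EuclideanSpace ℝ (Fin n)) :
    𝓓(Ω, ℝ) where
  toFun := fun y => ψ y * ((ε ^ n)⁻¹ * ρ (ε⁻¹ • (x - y)))
  contDiff' := by
    have h1 : ContDiff ℝ ∞ (fun y => ρ (ε⁻¹ • (x - y))) :=
      (ρ.smooth ⊤).comp ((contDiff_const.sub contDiff_id).const_smul _)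
    exact ψ.contDiff.mul (contDiff_const.mul h1)
  hasCompactSupport' := ψ.hasCompactSupport.mul_right
  tsupport_subset' := (tsupport_mul_subset_left (f := ψ)).trans ψ.tsupport_subset

/-- The regularisation `(ψ T) * ρ_ε` of the compactly supported distribution `ψ T`. -/
def regularize {n : ℕ} {𝕜 : Type*} [RCLike 𝕜]
    {Ω : TopologicalSpace.Opens (EuclideanSpace ℝ (Fin n))}
    (ρ : SchwartzMap (EuclideanSpace ℝ (Fin n)) ℝ) (ψ : 𝓓(Ω, ℝ)) (T : 𝓓'(Ω, 𝕜))
    (ε : I) (x : EuclideanSpace ℝ (Fin n)) : 𝕜 :=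
  T (kernel ψ ρ ε x)

/-- `ι` is the canonical embedding `𝓓'(Ω) → 𝒢(Ω)` belonging to the mollifier `ρ`: on every open set
`W` that is relatively compact in `Ω`, the generalized function `ι T` is the class of the net
`(ψ T) * ρ_ε`, for every cut-off `ψ` that equals one near the closure of `W`. -/
def IsCanonicalEmbedding {n : ℕ} {𝕜 : Type*} [RCLike 𝕜]
    {Ω : TopologicalSpace.Opens (EuclideanSpace ℝ (Fin n))}
    (ρ : SchwartzMap (EuclideanSpace ℝ (Fin n)) ℝ) (ι : 𝓓'(Ω, 𝕜) → Gen 𝕜 Ω) : Prop :=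
  ∀ (T : 𝓓'(Ω, 𝕜)) (u : moderate 𝕜 Ω), mk u = ι T →
    ∀ W : Set (EuclideanSpace ℝ (Fin n)), IsOpen W → IsCompact (closure W) → closure W ⊆ Ω →
      ∀ ψ : 𝓓(Ω, ℝ), (∀ᶠ y in 𝓝ˢ (closure W), ψ y = 1) →
        (∀ ε : I, ContDiffOn ℝ ∞ (regularize ρ ψ T ε) W) ∧
        IsNegligibleOn (fun ε x => extNet (u : I → smooth 𝕜 Ω) ε x - regularize ρ ψ T ε x) W

end

end Colombeau

/-!
# Distributions form a discrete subset of the Colombeau algebra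

The point of the proof is that a net cannot at the same time represent a nonzero distribution and
tend to zero at a positive power rate. If `u` represents `T`, then on each set of the exhaustion `u`
agrees up to a negligible net with the regularisations `(ψ T) * ρ_ε`, and these converge weakly to
`T` (`tendsto_integral_mul_regularize`). If moreover `u = O(ε ^ a)` for some `a > 0` on each set of
the exhaustion, the weak limit is zero, so `T = 0` (`Represents.eq_zero`). Now `D f g < 1` forces
`V_{mm} (f - g) > 0` for all `m`, so two embedded distributions at distance less than one coincide
(`eq_of_D_embedding_lt_one`). This gives injectivity and discreteness simultaneously.

The existence of the embedding rests on two facts. First, the regularisation is a moderate net, and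
it is negligible wherever the cut-off vanishes (`isModerateOn_regularize`,
`isNegligibleOn_regularize`). Both follow from the continuity of `T`, in the form of a seminorm
estimate on the test functions supported in a fixed compact set, applied to the kernels
`y ↦ ψ y ρ_ε (x - y)`; for negligibility, the rapid decay of `ρ` away from the origin beats all
powers of `ε`. Second, the local regularisations are glued by a partition of unity (`exists_glue`).
The seminorm estimate comes from factoring `T`, on these test functions, through the jet map into a
Banach space of continuous functions: by the Hahn–Banach theorem, `T` becomes a continuous linear
functional of the jet (`exists_eq_apply_jet`), so that differentiation with respect to a parameter
and integration over it commute with `T`.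

The norm is invariant under an invertible smooth function `h` because the derivatives of `h` and
`h⁻¹` are bounded on the relatively compact sets of the exhaustion, so that multiplication by
either does not decrease `V`.
-/

open scoped ContDiff Distributions Topology

namespace Colombeau

noncomputable section

/-! ### Families of functions as maps into a space of continuous functions -/

section slice

universe u

open scoped BoundedContinuousFunction

variable {E E' G : Type u} [NormedAddCommGroup G]

/-- The map `x ↦ Ψ(x, ·)|_K` with values in the space of (bounded) continuous functions on the
compact set `K`. -/
def slice [TopologicalSpace E] [TopologicalSpace E'] (K : Set E') [CompactSpace K]
    (Ψ : E × E' → G) (h : Continuous Ψ) (x : E) : K →ᵇ G :=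
  BoundedContinuousFunction.mkOfCompact ⟨fun y => Ψ (x, y), by fun_prop⟩

lemma continuous_slice [TopologicalSpace E] [TopologicalSpace E'] (K : Set E') [CompactSpace K]
    (Ψ : E × E' → G) (h : Continuous Ψ) : Continuous (slice K Ψ h) := by
  have h1 : Continuous fun x : E => (⟨fun y => Ψ (x, y), by fun_prop⟩ : C(K, G)) :=
    ContinuousMap.continuous_of_continuous_uncurry _
      (by change Continuous fun p : E × K => Ψ (p.1, p.2); fun_prop)
  exact (ContinuousMap.isometryEquivBoundedOfCompact K G).continuous.comp h1

variable [NormedAddCommGroup E] [NormedSpace ℝ E] [NormedSpace ℝ G]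

/-- A continuous function with values in `E →L[ℝ] G`, seen as a continuous linear map with values
in the continuous functions. -/
def applyCLM [TopologicalSpace E'] (K : Set E') [CompactSpace K] :
    (K →ᵇ (E →L[ℝ] G)) →L[ℝ] E →L[ℝ] (K →ᵇ G) :=
  LinearMap.mkContinuous₂
    (LinearMap.mk₂ ℝ (fun (f : K →ᵇ (E →L[ℝ] G)) (v : E) =>
        BoundedContinuousFunction.mkOfCompact ⟨fun y => f y v, by fun_prop⟩)
      (fun _ _ _ => by ext; rfl) (fun _ _ _ => by ext; rfl)
      (fun f v w => by ext y; exact map_add (f y) v w)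
      (fun c f v => by ext y; exact map_smul (f y) c v)) 1
    (fun f v => by
      rw [one_mul]
      refine (BoundedContinuousFunction.norm_le (by positivity)).2 fun y => ?_
      exact ((f y).le_opNorm v).trans
        (mul_le_mul_of_nonneg_right (f.norm_coe_le_norm y) (norm_nonneg _)))

/-- Differentiation of a family in its parameter, uniformly on a compact set: the increments of
`Ψ(·, y)` are controlled by the mean value inequality, uniformly in `y`, since the slices of the
partial derivative depend continuously on the parameter. -/
lemma hasFDerivAt_slice [TopologicalSpace E'] (K : Set E') [CompactSpace K] (Ψ : E × E' → G)
    (Ψ' : E × E' → E →L[ℝ] G) (h : Continuous Ψ) (h' : Continuous Ψ')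
    (hd : ∀ x y, HasFDerivAt (fun t => Ψ (t, y)) (Ψ' (x, y)) x) (x : E) :
    HasFDerivAt (slice K Ψ h) (applyCLM K (slice K Ψ' h' x)) x := by
  rw [hasFDerivAt_iff_isLittleO_nhds_zero, Asymptotics.isLittleO_iff]
  intro c hc
  obtain ⟨δ, hδ, hδ'⟩ := Metric.continuousAt_iff.1 (continuous_slice K Ψ' h').continuousAt c hc
  filter_upwards [Metric.ball_mem_nhds (0 : E) hδ] with v hv
  have hv : ‖v‖ < δ := by simpa using hv
  refine (BoundedContinuousFunction.norm_le (by positivity)).2 fun y => ?_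
  have key := (convex_ball x δ).norm_image_sub_le_of_norm_hasFDerivWithin_le'
    (f := fun t => Ψ (t, y)) (f' := fun t => Ψ' (t, y)) (φ := Ψ' (x, y)) (C := c)
    (fun t _ => (hd t y).hasFDerivWithinAt) (fun t ht => ?_) (Metric.mem_ball_self hδ)
    (show x + v ∈ Metric.ball x δ by simpa using hv)
  · rw [add_sub_cancel_left] at key
    exact key
  · have := hδ' (show dist t x < δ from ht)
    rw [dist_eq_norm] at this
    exact ((slice K Ψ' h' t - slice K Ψ' h' x).norm_coe_le_norm y).trans this.le

variable [NormedAddCommGroup E'] [NormedSpace ℝ E']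

theorem contDiff_slice (K : Set E') [CompactSpace K] (Ψ : E × E' → G) (h : ContDiff ℝ ∞ Ψ) :
    ContDiff ℝ ∞ (slice K Ψ h.continuous) := by
  refine contDiff_infty.2 fun m => ?_
  -- The target space changes in the induction step, from `G` to `E →L[ℝ] G`.
  induction m generalizing G with
  | zero => exact contDiff_zero.2 (continuous_slice K Ψ h.continuous)
  | succ m ih =>
    let Ψ' : E × E' → E →L[ℝ] G := fun z => (fderiv ℝ Ψ z).comp (ContinuousLinearMap.inl ℝ E E')
    have hΨ' : ContDiff ℝ ∞ Ψ' := (h.fderiv_right (m := ∞) (by simp)).clm_comp contDiff_const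
    have hd : ∀ x y, HasFDerivAt (fun t => Ψ (t, y)) (Ψ' (x, y)) x := fun x y => by
      have h1 : HasFDerivAt Ψ (fderiv ℝ Ψ (x, y)) (x, y) :=
        (h.differentiable (by simp)).differentiableAt.hasFDerivAt
      exact h1.comp x (hasFDerivAt_prodMk_left x y)
    have hA : ContDiff ℝ m (applyCLM K : (K →ᵇ (E →L[ℝ] G)) →L[ℝ] E →L[ℝ] (K →ᵇ G)) :=
      ContinuousLinearMap.contDiff _
    refine contDiff_succ_iff_hasFDerivAt.2 ⟨fun x => applyCLM K (slice K Ψ' hΨ'.continuous x),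
      hA.comp (ih Ψ' hΨ'), ?_⟩
    exact hasFDerivAt_slice K Ψ Ψ' h.continuous hΨ'.continuous hd

lemma iteratedFDeriv_slice_apply (K : Set E') [CompactSpace K] (Ψ : E × E' → G)
    (h : ContDiff ℝ ∞ Ψ) (j : ℕ) (x : E) (v : Fin j → E) (y : K) :
    iteratedFDeriv ℝ j (slice K Ψ h.continuous) x v y
      = iteratedFDeriv ℝ j (fun t => Ψ (t, y)) x v := by
  have := (BoundedContinuousFunction.evalCLM ℝ y : (K →ᵇ G) →L[ℝ] G).iteratedFDeriv_comp_left
    (contDiff_slice K Ψ h).contDiffAt (x := x) (i := j) (by exact_mod_cast le_top)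
  exact (congrArg (fun L => L v) this).symm

lemma iteratedFDeriv_prodMk_left (Ψ : E × E' → G) (h : ContDiff ℝ ∞ Ψ) (j : ℕ) (x : E) (y : E') :
    iteratedFDeriv ℝ j (fun t => Ψ (t, y)) x =
      (iteratedFDeriv ℝ j Ψ (x, y)).compContinuousLinearMap
        fun _ => ContinuousLinearMap.inl ℝ E E' := by
  have h1 : (fun t => Ψ (t, y)) = (fun z => Ψ (z + (0, y))) ∘ ContinuousLinearMap.inl ℝ E E' := by
    ext t; simp
  have h2 : ContDiff ℝ ∞ fun z => Ψ (z + (0, y)) := h.comp (contDiff_id.add contDiff_const)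
  rw [h1, ContinuousLinearMap.iteratedFDeriv_comp_right _ h2 _ (by exact_mod_cast le_top),
    iteratedFDeriv_comp_add_right]
  simp

lemma iteratedFDeriv_prodMk_right (Ψ : E × E' → G) (h : ContDiff ℝ ∞ Ψ) (j : ℕ) (x : E) (y : E') :
    iteratedFDeriv ℝ j (fun t => Ψ (x, t)) y =
      (iteratedFDeriv ℝ j Ψ (x, y)).compContinuousLinearMap
        fun _ => ContinuousLinearMap.inr ℝ E E' := by
  have h1 : (fun t => Ψ (x, t)) = (fun z => Ψ (z + (x, 0))) ∘ ContinuousLinearMap.inr ℝ E E' := by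
    ext t; simp
  have h2 : ContDiff ℝ ∞ fun z => Ψ (z + (x, 0)) := h.comp (contDiff_id.add contDiff_const)
  rw [h1, ContinuousLinearMap.iteratedFDeriv_comp_right _ h2 _ (by exact_mod_cast le_top),
    iteratedFDeriv_comp_add_right]
  simp

lemma norm_iteratedFDeriv_slice_le (K : Set E') [CompactSpace K] (Ψ : E × E' → G)
    (h : ContDiff ℝ ∞ Ψ) (j : ℕ) (x : E) {B : ℝ} (hB : 0 ≤ B)
    (hK : ∀ y ∈ K, ‖iteratedFDeriv ℝ j Ψ (x, y)‖ ≤ B) :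
    ‖iteratedFDeriv ℝ j (slice K Ψ h.continuous) x‖ ≤ B := by
  refine ContinuousMultilinearMap.opNorm_le_bound hB fun v => ?_
  refine (BoundedContinuousFunction.norm_le (by positivity)).2 fun y => ?_
  rw [iteratedFDeriv_slice_apply K Ψ h, iteratedFDeriv_prodMk_left Ψ h,
    ContinuousMultilinearMap.compContinuousLinearMap_apply]
  refine (ContinuousMultilinearMap.le_opNorm _ _).trans ?_
  refine mul_le_mul (hK y y.2) ?_ (by positivity) hB
  simp

end slice

section jet

universe u

open scoped BoundedContinuousFunction

variable {E E' G : Type u} [NormedAddCommGroup E] [NormedSpace ℝ E] [NormedAddCommGroup E']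
  [NormedSpace ℝ E'] [NormedAddCommGroup G] [NormedSpace ℝ G]

/-- The Banach space in which the jets of order `N` on `K` of smooth functions live. -/
def JetSpace (K : Set E') (N : ℕ) (G : Type u) [NormedAddCommGroup G] [NormedSpace ℝ G] :
    Type u :=
  ∀ i : Fin (N + 1), K →ᵇ (E' [×i]→L[ℝ] G)

instance (K : Set E') (N : ℕ) : NormedAddCommGroup (JetSpace K N G) :=
  inferInstanceAs (NormedAddCommGroup (∀ i : Fin (N + 1), K →ᵇ (E' [×i]→L[ℝ] G)))

instance (K : Set E') (N : ℕ) : NormedSpace ℝ (JetSpace K N G) :=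
  inferInstanceAs (NormedSpace ℝ (∀ i : Fin (N + 1), K →ᵇ (E' [×i]→L[ℝ] G)))

instance (K : Set E') (N : ℕ) [CompleteSpace G] : CompleteSpace (JetSpace K N G) :=
  inferInstanceAs (CompleteSpace (∀ i : Fin (N + 1), K →ᵇ (E' [×i]→L[ℝ] G)))

@[ext]
lemma JetSpace.ext {K : Set E'} {N : ℕ} {j j' : JetSpace K N G} (h : ∀ i, j i = j' i) : j = j' :=
  funext h

lemma JetSpace.norm_le_iff {K : Set E'} {N : ℕ} {j : JetSpace K N G} {B : ℝ} (hB : 0 ≤ B) :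
    ‖j‖ ≤ B ↔ ∀ i, ‖j i‖ ≤ B :=
  pi_norm_le_iff_of_nonneg (x := (j : ∀ i : Fin (N + 1), K →ᵇ (E' [×i]→L[ℝ] G))) hB

/-- The component of order `i` of a jet. -/
def JetSpace.proj (K : Set E') (N : ℕ) (i : Fin (N + 1)) :
    JetSpace K N G →L[ℝ] (K →ᵇ (E' [×i]→L[ℝ] G)) :=
  let P : JetSpace K N G →ₗ[ℝ] (K →ᵇ (E' [×i]→L[ℝ] G)) :=
    { toFun := fun j => j i
      map_add' := fun _ _ => rfl
      map_smul' := fun _ _ => rfl }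
  have hP : ∀ j, ‖P j‖ ≤ 1 * ‖j‖ := fun j => by
    rw [one_mul]
    exact (JetSpace.norm_le_iff (K := K) (N := N) (G := G) (norm_nonneg j)).1 le_rfl i
  { P with cont := AddMonoidHomClass.continuous_of_bound P 1 hP }

@[simp]
lemma JetSpace.proj_apply (K : Set E') (N : ℕ) (i : Fin (N + 1)) (j : JetSpace K N G) :
    JetSpace.proj K N i j = j i := rfl

lemma contDiff_jetSpace_iff {K : Set E'} {N : ℕ} {f : E → JetSpace K N G} :
    ContDiff ℝ ∞ f ↔ ∀ i, ContDiff ℝ ∞ fun x => f x i :=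
  contDiff_pi (Φ := (f : E → ∀ i : Fin (N + 1), K →ᵇ (E' [×i]→L[ℝ] G)))

lemma continuous_iteratedFDeriv_of_smooth {f : E' → G} (hf : ContDiff ℝ ∞ f) (i : ℕ) :
    Continuous (iteratedFDeriv ℝ i f) :=
  hf.continuous_iteratedFDeriv (by exact_mod_cast le_top)

/-- The derivatives of order at most `N` of a smooth function, on the compact set `K`. -/
def jet (K : Set E') [CompactSpace K] (N : ℕ) (f : E' → G) (hf : ContDiff ℝ ∞ f) :
    JetSpace K N G :=
  fun i => BoundedContinuousFunction.mkOfCompact ⟨fun y => iteratedFDeriv ℝ i f y,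
    (continuous_iteratedFDeriv_of_smooth hf i).comp continuous_subtype_val⟩

@[simp]
lemma jet_apply (K : Set E') [CompactSpace K] (N : ℕ) (f : E' → G) (hf : ContDiff ℝ ∞ f)
    (i : Fin (N + 1)) (y : K) : jet K N f hf i y = iteratedFDeriv ℝ i f y := rfl

lemma contDiff_fiber {Ψ : E × E' → G} (h : ContDiff ℝ ∞ Ψ) (x : E) :
    ContDiff ℝ ∞ fun y => Ψ (x, y) :=
  h.comp (contDiff_prodMk_right x)

/-- The partial derivative of order `i` in the second variable. -/
def partialSnd (i : ℕ) (Ψ : E × E' → G) : E × E' → E' [×i]→L[ℝ] G :=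
  ContinuousMultilinearMap.compContinuousLinearMapL
    (fun _ => ContinuousLinearMap.inr ℝ E E') ∘ iteratedFDeriv ℝ i Ψ

lemma partialSnd_apply {Ψ : E × E' → G} (h : ContDiff ℝ ∞ Ψ) (i : ℕ) (x : E) (y : E') :
    partialSnd i Ψ (x, y) = iteratedFDeriv ℝ i (fun t => Ψ (x, t)) y :=
  (iteratedFDeriv_prodMk_right Ψ h i x y).symm

lemma contDiff_partialSnd {Ψ : E × E' → G} (h : ContDiff ℝ ∞ Ψ) (i : ℕ) :
    ContDiff ℝ ∞ (partialSnd i Ψ) :=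
  (ContinuousLinearMap.contDiff _).comp
    (h.iteratedFDeriv_right (m := ∞) (by exact_mod_cast le_top))

lemma norm_iteratedFDeriv_iteratedFDeriv_eq {Ψ : E → G} (i j : ℕ) (z : E) :
    ‖iteratedFDeriv ℝ j (iteratedFDeriv ℝ i Ψ) z‖ = ‖iteratedFDeriv ℝ (j + i) Ψ z‖ := by
  induction i generalizing j z with
  | zero =>
    rw [iteratedFDeriv_zero_eq_comp]
    exact LinearIsometryEquiv.norm_iteratedFDeriv_comp_left _ _ _ _
  | succ i ih =>
    let e : (E →L[ℝ] (E [×i]→L[ℝ] G)) ≃ₗᵢ[ℝ] (E [×(i + 1)]→L[ℝ] G) :=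
      (continuousMultilinearCurryLeftEquiv ℝ (fun _ : Fin (i + 1) => E) G).symm
    have h1 : iteratedFDeriv ℝ (i + 1) Ψ = e ∘ fderiv ℝ (iteratedFDeriv ℝ i Ψ) :=
      iteratedFDeriv_succ_eq_comp_left
    rw [h1, LinearIsometryEquiv.norm_iteratedFDeriv_comp_left (𝕜 := ℝ)
      (F := E →L[ℝ] (E [×i]→L[ℝ] G))
      (G := E [×(i + 1)]→L[ℝ] G) e, norm_iteratedFDeriv_fderiv, ih,
      show j + 1 + i = j + (i + 1) by ring]

lemma norm_iteratedFDeriv_partialSnd_le {Ψ : E × E' → G} (h : ContDiff ℝ ∞ Ψ) (i j : ℕ)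
    (z : E × E') :
    ‖iteratedFDeriv ℝ j (partialSnd i Ψ) z‖ ≤ ‖iteratedFDeriv ℝ (j + i) Ψ z‖ := by
  have h1 : ContDiff ℝ ∞ (iteratedFDeriv ℝ i Ψ) :=
    h.iteratedFDeriv_right (m := ∞) (by exact_mod_cast le_top)
  let L : ((E × E') [×i]→L[ℝ] G) →L[ℝ] (E' [×i]→L[ℝ] G) :=
    ContinuousMultilinearMap.compContinuousLinearMapL fun _ => ContinuousLinearMap.inr ℝ E E'
  have hL : ‖L‖ ≤ 1 := by
    refine ContinuousLinearMap.opNorm_le_bound _ zero_le_one fun f => ?_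
    refine ContinuousMultilinearMap.opNorm_le_bound (by positivity) fun v => ?_
    refine (f.le_opNorm _).trans ?_
    rw [one_mul]
    refine mul_le_mul_of_nonneg_left (le_of_eq ?_) (norm_nonneg _)
    simp
  have h2 := L.norm_iteratedFDeriv_comp_left (h1.contDiffAt (x := z)) (n := j)
    (by exact_mod_cast le_top)
  rw [← norm_iteratedFDeriv_iteratedFDeriv_eq]
  exact h2.trans (mul_le_of_le_one_left (norm_nonneg _) hL)

lemma jet_eq_slice (K : Set E') [CompactSpace K] (N : ℕ) {Ψ : E × E' → G} (h : ContDiff ℝ ∞ Ψ)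
    (x : E) :
    jet K N (fun y => Ψ (x, y)) (contDiff_fiber h x) =
      fun i : Fin (N + 1) => slice K (partialSnd i Ψ) (contDiff_partialSnd h i).continuous x := by
  ext1 i
  ext1 y
  exact (partialSnd_apply h i x y).symm

theorem contDiff_jet (K : Set E') [CompactSpace K] (N : ℕ) {Ψ : E × E' → G}
    (h : ContDiff ℝ ∞ Ψ) :
    ContDiff ℝ ∞ fun x => jet K N (fun y => Ψ (x, y)) (contDiff_fiber h x) := by
  simp_rw [jet_eq_slice K N h]
  exact contDiff_jetSpace_iff.2 fun i => contDiff_slice K _ (contDiff_partialSnd h i)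

theorem norm_iteratedFDeriv_jet_le (K : Set E') [CompactSpace K] (N : ℕ) {Ψ : E × E' → G}
    (h : ContDiff ℝ ∞ Ψ) (j : ℕ) (x : E) {B : ℝ} (hB : 0 ≤ B)
    (hK : ∀ y ∈ K, ∀ i ≤ N, ‖iteratedFDeriv ℝ (j + i) Ψ (x, y)‖ ≤ B) :
    ‖iteratedFDeriv ℝ j (fun x => jet K N (fun y => Ψ (x, y)) (contDiff_fiber h x)) x‖
      ≤ B := by
  have h1 := contDiff_jet K N h
  simp_rw [jet_eq_slice K N h] at h1 ⊢
  refine ContinuousMultilinearMap.opNorm_le_bound hB fun v => ?_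
  refine (JetSpace.norm_le_iff (by positivity)).2 fun i => ?_
  have h2 := ContinuousLinearMap.iteratedFDeriv_comp_left (G := K →ᵇ (E' [×i]→L[ℝ] G))
    (JetSpace.proj K N i) h1.contDiffAt (x := x) (i := j)
    (by exact_mod_cast le_top)
  have h3 := (JetSpace.proj_apply K N i _).symm.trans (congrArg (fun L => L v) h2).symm
  refine (le_of_eq (congrArg norm h3)).trans ?_
  refine (ContinuousMultilinearMap.le_opNorm _ _).trans ?_
  refine mul_le_mul_of_nonneg_right ?_ (by positivity)
  refine norm_iteratedFDeriv_slice_le K _ (contDiff_partialSnd h i) j x hB fun y hy => ?_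
  exact (norm_iteratedFDeriv_partialSnd_le h i j _).trans
    (hK y hy i (Nat.lt_succ_iff.1 i.2))

end jet

/-! ### Distributions applied to smooth families of test functions -/

section distribution

open scoped BoundedContinuousFunction
open MeasureTheory

variable {n : ℕ} {𝕜 : Type*} [RCLike 𝕜] {Ω : TopologicalSpace.Opens (EuclideanSpace ℝ (Fin n))}

local notation "𝔼" => EuclideanSpace ℝ (Fin n)

/-- On the test functions supported in a fixed compact set, a distribution is a continuous linear
functional of finitely many derivatives: the seminorm estimate lets it factor through the jets, and
the Hahn–Banach theorem extends it to the whole Banach space of jets. -/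
theorem exists_eq_apply_jet (T : 𝓓'(Ω, 𝕜)) (K : Set 𝔼) [CompactSpace K] (hK : K ⊆ Ω) :
    ∃ (N : ℕ) (L : JetSpace K N ℝ →L[ℝ] 𝕜), ∀ φ : 𝓓(Ω, ℝ), Function.support φ ⊆ K →
      T φ = L (jet K N φ φ.contDiff) := by
  let K' : TopologicalSpace.Compacts 𝔼 := ⟨K, isCompact_iff_compactSpace.2 inferInstance⟩
  let A : 𝓓_{K'}(𝔼, ℝ) →ₗ[ℝ] 𝕜 :=
    { toFun := fun f => T (TestFunction.ofSupportedIn (K := K') hK f)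
      map_add' := fun f g => map_add T (TestFunction.ofSupportedIn (K := K') hK f)
        (TestFunction.ofSupportedIn (K := K') hK g)
      map_smul' := fun c f => map_smul T c (TestFunction.ofSupportedIn (K := K') hK f) }
  have hA : Continuous A :=
    (map_continuous T).comp (TestFunction.continuous_ofSupportedIn (K := K') hK)
  obtain ⟨s, C, -, hC⟩ := Seminorm.bound_of_continuous
    (ContDiffMapSupportedIn.withSeminorms ℝ 𝔼 ℝ ⊤ K') ((normSeminorm ℝ 𝕜).comp A)
    (continuous_norm.comp hA)
  let N := s.sup id
  let J : 𝓓_{K'}(𝔼, ℝ) →ₗ[ℝ] JetSpace K N ℝ :=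
    { toFun := fun f => jet K N f f.contDiff
      map_add' := fun f g => by
        ext i y : 3
        exact congrFun (congrArg DFunLike.coe (iteratedFDeriv_add_apply
          (f.contDiff.contDiffAt.of_le (by exact_mod_cast le_top))
          (g.contDiff.contDiffAt.of_le (by exact_mod_cast le_top)))) _
      map_smul' := fun c f => by
        ext i y : 3
        exact congrFun (congrArg DFunLike.coe (iteratedFDeriv_const_smul_apply
          (f.contDiff.contDiffAt.of_le (by exact_mod_cast le_top)))) _ }
  -- the seminorms of order at most `N` that control `A` are dominated by the norm of the jet
  have hbound : ∀ f, ‖A f‖ ≤ C * ‖J f‖ := fun f => by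
    refine (hC f).trans ?_
    refine mul_le_mul_of_nonneg_left ?_ C.2
    refine Seminorm.finset_sup_apply_le (norm_nonneg _) fun i hi => ?_
    refine (ContDiffMapSupportedIn.seminorm_top_le_iff ℝ (norm_nonneg _) i f).2 fun y hy => ?_
    have hi' : i < N + 1 := Nat.lt_succ_iff.2 (Finset.le_sup (f := id) hi)
    exact ((J f ⟨i, hi'⟩).norm_coe_le_norm ⟨y, hy⟩).trans
      ((JetSpace.norm_le_iff (norm_nonneg _)).1 le_rfl ⟨i, hi'⟩)
  have hJ : Function.Injective J := by
    intro f g hfg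
    ext y
    by_cases hy : y ∈ K
    · have h1 : iteratedFDeriv ℝ 0 f y = iteratedFDeriv ℝ 0 g y :=
        congrArg (fun j : JetSpace K N ℝ => j 0 ⟨y, hy⟩) hfg
      simpa using congrArg (fun m => m 0) h1
    · rw [f.zero_on_compl hy, g.zero_on_compl hy]
  let e := LinearEquiv.ofInjective J hJ
  let g : LinearMap.range J →L[ℝ] 𝕜 := (A ∘ₗ e.symm.toLinearMap).mkContinuous C fun j => by
    obtain ⟨f, rfl⟩ := e.surjective j
    simpa [e] using hbound f
  have : FiniteDimensional ℝ 𝕜 := inferInstance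
  obtain ⟨L, hL⟩ := g.exist_extension_of_finiteDimensional_range
  refine ⟨N, L, fun φ hφ => ?_⟩
  let f : 𝓓_{K'}(𝔼, ℝ) := ContDiffMapSupportedIn.of_support_subset φ.contDiff hφ
  have h1 : g (e f) = L (J f) := congrArg (fun l => l (e f)) hL
  have h2 : g (e f) = A f := by simp [g]
  exact h2.symm.trans h1

/-- A distribution may be differentiated under a smooth parameter, and the derivatives are bounded
by those of the family of test functions, with a constant and a loss of derivatives that depend
only on the compact set that carries the supports. -/
theorem exists_bound_apply_family (T : 𝓓'(Ω, 𝕜)) (K : Set 𝔼) (hc : IsCompact K) (hK : K ⊆ Ω) :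
    ∃ (N : ℕ) (C : ℝ), 0 ≤ C ∧ ∀ φ : 𝔼 → 𝓓(Ω, ℝ),
      ContDiff ℝ ∞ (fun z : 𝔼 × 𝔼 => φ z.1 z.2) → (∀ x, Function.support (φ x) ⊆ K) →
      ContDiff ℝ ∞ (fun x => T (φ x)) ∧
      ∀ (j : ℕ) (x : 𝔼) (B : ℝ), 0 ≤ B → (∀ y ∈ K, ∀ i ≤ N,
        ‖iteratedFDeriv ℝ (j + i) (fun z : 𝔼 × 𝔼 => φ z.1 z.2) (x, y)‖ ≤ B) →
        ‖iteratedFDeriv ℝ j (fun x => T (φ x)) x‖ ≤ C * B := by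
  have : CompactSpace K := isCompact_iff_compactSpace.1 hc
  obtain ⟨N, L, hL⟩ := exists_eq_apply_jet T K hK
  refine ⟨N, ‖L‖, norm_nonneg _, fun φ hφ hs => ?_⟩
  have h1 : (fun x => T (φ x)) = L ∘ fun x => jet K N (fun y => (fun z : 𝔼 × 𝔼 => φ z.1 z.2) (x, y))
      (contDiff_fiber hφ x) := funext fun x => hL (φ x) (hs x)
  have h2 := contDiff_jet K N hφ
  refine ⟨h1 ▸ L.contDiff.comp h2, fun j x B hB hb => ?_⟩
  rw [h1]
  refine (L.norm_iteratedFDeriv_comp_left h2.contDiffAt (n := j)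
    (by exact_mod_cast le_top)).trans ?_
  exact mul_le_mul_of_nonneg_left (norm_iteratedFDeriv_jet_le K N hφ j x hB hb) (norm_nonneg _)

/-- Integration over a compact set, as a functional on the continuous functions. -/
def integralCLM (K : Set 𝔼) [CompactSpace K]
    [IsFiniteMeasure ((volume : Measure 𝔼).comap ((↑) : K → 𝔼))] :
    (K →ᵇ ℝ) →L[ℝ] ℝ :=
  LinearMap.mkContinuous
    { toFun := fun f => ∫ x, f x ∂volume.comap ((↑) : K → 𝔼)
      map_add' := fun f g => integral_add (f.integrable _) (g.integrable _)
      map_smul' := fun c f => integral_const_mul c f }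
    (((volume : Measure 𝔼).comap ((↑) : K → 𝔼)).real Set.univ)
    (fun f => by
      rw [mul_comm]
      exact norm_integral_le_of_norm_le_const (Filter.Eventually.of_forall f.norm_coe_le_norm))

lemma integral_eq_integral_subtype {G : Type*} [NormedAddCommGroup G] [NormedSpace ℝ G] {K : Set 𝔼}
    (hK : IsCompact K) {f : 𝔼 → G} (hf : ∀ x ∉ K, f x = 0) :
    ∫ x, f x = ∫ x : K, f x ∂volume.comap ((↑) : K → 𝔼) := by
  rw [integral_subtype_comap hK.measurableSet f, setIntegral_eq_integral_of_forall_compl_eq_zero hf]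

lemma isFiniteMeasure_comap_subtype {K : Set 𝔼} (hK : IsCompact K) :
    IsFiniteMeasure ((volume : Measure 𝔼).comap ((↑) : K → 𝔼)) := ⟨by
  rw [comap_subtype_coe_apply hK.measurableSet, Subtype.coe_image_univ]
  exact hK.measure_lt_top⟩

/-- Differentiation under the integral sign, for a smooth family that is compactly supported in the
variable of integration: the integral is a continuous linear functional of the slice. -/
lemma contDiff_integral_family {Φ : 𝔼 × 𝔼 → ℝ} (hΦ : ContDiff ℝ ∞ Φ) {K : Set 𝔼}
    (hK : IsCompact K) (h0 : ∀ x ∉ K, ∀ y, Φ (x, y) = 0) :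
    ContDiff ℝ ∞ (fun y => ∫ x, Φ (x, y)) ∧ ∀ (i : ℕ) (y : 𝔼) (v : Fin i → 𝔼),
      iteratedFDeriv ℝ i (fun y => ∫ x, Φ (x, y)) y v
        = ∫ x, iteratedFDeriv ℝ i (fun y => Φ (x, y)) y v := by
  have : CompactSpace K := isCompact_iff_compactSpace.1 hK
  have := isFiniteMeasure_comap_subtype hK
  let Ψ : 𝔼 × 𝔼 → ℝ := fun z => Φ (z.2, z.1)
  have hΨ : ContDiff ℝ ∞ Ψ := hΦ.comp (contDiff_snd.prodMk contDiff_fst)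
  have h1 : (fun y => ∫ x, Φ (x, y)) = integralCLM K ∘ slice K Ψ hΨ.continuous :=
    funext fun y => integral_eq_integral_subtype hK fun x hx => h0 x hx y
  refine ⟨h1 ▸ (integralCLM K).contDiff.comp (contDiff_slice K Ψ hΨ), fun i y v => ?_⟩
  rw [h1, (integralCLM K).iteratedFDeriv_comp_left (contDiff_slice K Ψ hΨ).contDiffAt
    (by exact_mod_cast le_top)]
  rw [integral_eq_integral_subtype hK]
  · exact integral_congr_ae (Filter.Eventually.of_forall fun x =>
      iteratedFDeriv_slice_apply K Ψ hΨ i y v x)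
  · intro x hx
    have : (fun y => Φ (x, y)) = fun _ => 0 := funext fun y => h0 x hx y
    rw [this]
    simp

/-- A distribution commutes with the integration of a smooth, compactly supported family of test
functions. -/
theorem apply_integral_family (T : 𝓓'(Ω, 𝕜)) {K K₁ : Set 𝔼} (hc : IsCompact K) (hK : K ⊆ Ω)
    (hc₁ : IsCompact K₁) (φ : 𝔼 → 𝓓(Ω, ℝ))
    (hφ : ContDiff ℝ ∞ (fun z : 𝔼 × 𝔼 => φ z.1 z.2)) (hs : ∀ x, Function.support (φ x) ⊆ K)
    (h0 : ∀ x ∉ K₁, ∀ y, φ x y = 0) (θ : 𝓓(Ω, ℝ)) (hθ : ∀ y, θ y = ∫ x, φ x y) :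
    T θ = ∫ x, T (φ x) := by
  have : CompactSpace K := isCompact_iff_compactSpace.1 hc
  obtain ⟨N, L, hL⟩ := exists_eq_apply_jet T K hK
  let j : 𝔼 → JetSpace K N ℝ := fun x =>
    jet K N (fun y => (fun z : 𝔼 × 𝔼 => φ z.1 z.2) (x, y)) (contDiff_fiber hφ x)
  have hj : Continuous j := (contDiff_jet K N hφ).continuous
  have hj0 : ∀ x ∉ K₁, j x = 0 := fun x hx => by
    have : (fun y => φ x y) = fun _ => 0 := funext fun y => h0 x hx y
    ext i y : 3
    simp only [j, jet_apply, this, iteratedFDeriv_fun_zero]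
    rfl
  have hint : Integrable j := hj.integrable_of_hasCompactSupport (HasCompactSupport.intro hc₁ hj0)
  have h1 : ∫ x, T (φ x) = L (∫ x, j x) := by
    rw [← L.integral_comp_comm hint]
    exact integral_congr_ae (Filter.Eventually.of_forall fun x => hL (φ x) (hs x))
  have hsθ : Function.support θ ⊆ K := by
    intro y hy
    by_contra hyK
    refine hy ?_
    rw [hθ]
    refine integral_eq_zero_of_ae (Filter.Eventually.of_forall fun x => ?_)
    by_contra h
    exact hyK (hs x h)
  rw [h1, hL θ hsθ]
  congr 1
  ext i y v
  let P : JetSpace K N ℝ →L[ℝ] ℝ :=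
    (ContinuousMultilinearMap.apply ℝ (fun _ : Fin i => 𝔼) ℝ v).comp
      ((BoundedContinuousFunction.evalCLM ℝ y).comp
        (JetSpace.proj K N i))
  have h2 : P (∫ x, j x) = ∫ x, P (j x) := (P.integral_comp_comm hint).symm
  have h3 : (θ : 𝔼 → ℝ) = fun y => ∫ x, (fun z : 𝔼 × 𝔼 => φ z.1 z.2) (x, y) := funext hθ
  refine Eq.trans ?_ h2.symm
  rw [jet_apply]
  simp only [h3]
  exact (contDiff_integral_family hφ hc₁ h0).2 i y v

end distribution

/-! ### Estimates for the regularisation of a distribution -/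

section regularize

variable {n : ℕ} {𝕜 : Type*} [RCLike 𝕜] {Ω : TopologicalSpace.Opens (EuclideanSpace ℝ (Fin n))}

local notation "𝔼" => EuclideanSpace ℝ (Fin n)

lemma kernel_apply (ψ : 𝓓(Ω, ℝ)) (ρ : SchwartzMap 𝔼 ℝ) (ε : ℝ) (x y : 𝔼) :
    kernel ψ ρ ε x y = ψ y * ((ε ^ n)⁻¹ * ρ (ε⁻¹ • (x - y))) := rfl

lemma contDiff_kernel (ψ : 𝓓(Ω, ℝ)) (ρ : SchwartzMap 𝔼 ℝ) (ε : ℝ) :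
    ContDiff ℝ ∞ fun z : 𝔼 × 𝔼 => kernel ψ ρ ε z.1 z.2 := by
  have h1 : ContDiff ℝ ∞ fun z : 𝔼 × 𝔼 => ρ (ε⁻¹ • (z.1 - z.2)) :=
    (ρ.smooth ⊤).comp ((contDiff_fst.sub contDiff_snd).const_smul _)
  exact (ψ.contDiff.comp contDiff_snd).mul (contDiff_const.mul h1)

lemma support_kernel_subset (ψ : 𝓓(Ω, ℝ)) (ρ : SchwartzMap 𝔼 ℝ) (ε : ℝ) (x : 𝔼) :
    Function.support (kernel ψ ρ ε x) ⊆ tsupport ψ := fun y hy =>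
  subset_tsupport _ fun h => hy (by rw [kernel_apply, h, zero_mul])

lemma norm_iteratedFDeriv_comp_clm_le {E F G : Type*} [NormedAddCommGroup E] [NormedSpace ℝ E]
    [NormedAddCommGroup F] [NormedSpace ℝ F] [NormedAddCommGroup G] [NormedSpace ℝ G]
    {f : F → G} (hf : ContDiff ℝ ∞ f) (g : E →L[ℝ] F) (i : ℕ) (x : E) :
    ‖iteratedFDeriv ℝ i (fun x => f (g x)) x‖ ≤ ‖iteratedFDeriv ℝ i f (g x)‖ * ‖g‖ ^ i := by
  have h := g.iteratedFDeriv_comp_right hf x (i := i) (by exact_mod_cast le_top)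
  refine (le_of_eq (congrArg norm h)).trans
    ((ContinuousMultilinearMap.norm_compContinuousLinearMap_le _ _).trans ?_)
  simp

/-- The Leibniz rule for the kernel, in terms of the derivatives of its two factors. -/
lemma norm_iteratedFDeriv_kernel_le (ψ : 𝓓(Ω, ℝ)) (ρ : SchwartzMap 𝔼 ℝ) {ε : ℝ} (hε : 0 < ε)
    (m : ℕ) (x y : 𝔼) :
    ‖iteratedFDeriv ℝ m (fun z : 𝔼 × 𝔼 => kernel ψ ρ ε z.1 z.2) (x, y)‖ ≤
      ∑ i ∈ Finset.range (m + 1), (m.choose i : ℝ) * ‖iteratedFDeriv ℝ i ψ y‖ *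
        ((ε ^ n)⁻¹ * ‖iteratedFDeriv ℝ (m - i) ρ (ε⁻¹ • (x - y))‖ * (2 * ε⁻¹) ^ (m - i)) := by
  have hρ : ContDiff ℝ ∞ ρ := ρ.smooth ⊤
  let A : 𝔼 × 𝔼 →L[ℝ] 𝔼 :=
    ε⁻¹ • (ContinuousLinearMap.fst ℝ 𝔼 𝔼 - ContinuousLinearMap.snd ℝ 𝔼 𝔼)
  have hA : ‖A‖ ≤ 2 * ε⁻¹ := by
    refine (norm_smul_le ε⁻¹ (ContinuousLinearMap.fst ℝ 𝔼 𝔼 -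
      ContinuousLinearMap.snd ℝ 𝔼 𝔼)).trans ?_
    rw [Real.norm_of_nonneg (by positivity), mul_comm]
    refine mul_le_mul_of_nonneg_right ?_ (by positivity)
    refine (norm_sub_le _ _).trans ?_
    linarith [ContinuousLinearMap.norm_fst_le ℝ 𝔼 𝔼, ContinuousLinearMap.norm_snd_le ℝ 𝔼 𝔼]
  have h1 : ContDiff ℝ ∞ fun z : 𝔼 × 𝔼 => ψ z.2 := ψ.contDiff.comp contDiff_snd
  have h2 : ContDiff ℝ ∞ fun w : 𝔼 => (ε ^ n)⁻¹ • ρ w := hρ.const_smul _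
  have h3 : ContDiff ℝ ∞ fun z : 𝔼 × 𝔼 => (ε ^ n)⁻¹ • ρ (A z) := h2.comp A.contDiff
  refine (norm_iteratedFDeriv_mul_le h1 h3 (x, y) (n := m) (by exact_mod_cast le_top)).trans ?_
  refine Finset.sum_le_sum fun i _ => ?_
  refine mul_le_mul (mul_le_mul_of_nonneg_left ?_ (by positivity)) ?_ (norm_nonneg _)
    (by positivity)
  · refine (norm_iteratedFDeriv_comp_clm_le ψ.contDiff (ContinuousLinearMap.snd ℝ 𝔼 𝔼) i
      (x, y)).trans ?_
    refine mul_le_of_le_one_right (norm_nonneg _) (pow_le_one₀ (norm_nonneg _) ?_)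
    exact ContinuousLinearMap.norm_snd_le ..
  · refine (norm_iteratedFDeriv_comp_clm_le h2 A (m - i) (x, y)).trans ?_
    have h4 : iteratedFDeriv ℝ (m - i) (fun w : 𝔼 => (ε ^ n)⁻¹ • ρ w) (A (x, y)) =
        (ε ^ n)⁻¹ • iteratedFDeriv ℝ (m - i) ρ (A (x, y)) :=
      iteratedFDeriv_const_smul_apply' (contDiff_infty.1 hρ (m - i)).contDiffAt
    rw [h4, norm_smul, Real.norm_of_nonneg (by positivity)]
    exact mul_le_mul_of_nonneg_left (pow_le_pow_left₀ (norm_nonneg _) hA _) (by positivity)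

/-- Rapid decay of the kernel off the support of the cut-off. The exponent `M = 0` gives a
polynomial bound that holds everywhere. -/
lemma exists_kernel_bound (ψ : 𝓓(Ω, ℝ)) (ρ : SchwartzMap 𝔼 ℝ) (m M : ℕ) :
    ∃ C : ℝ, 0 ≤ C ∧ ∀ ε : ℝ, 0 < ε → ε ≤ 1 → ∀ (δ : ℝ), 0 ≤ δ → ∀ x y : 𝔼,
      (y ∈ tsupport ψ → δ ≤ ‖x - y‖) →
      δ ^ M * ‖iteratedFDeriv ℝ m (fun z : 𝔼 × 𝔼 => kernel ψ ρ ε z.1 z.2) (x, y)‖ ≤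
        C * ((ε ^ n)⁻¹ * ε⁻¹ ^ m * ε ^ M) := by
  have ha : ∀ i : ℕ, ∃ a : ℝ, ∀ y, ‖iteratedFDeriv ℝ i ψ y‖ ≤ a := fun i =>
    (continuous_iteratedFDeriv_of_smooth ψ.contDiff i).bounded_above_of_compact_support
      (ψ.hasCompactSupport.iteratedFDeriv i)
  choose a ha using ha
  choose b hb0 hb using fun j : ℕ => ρ.decay M j
  have ha0 : ∀ i, 0 ≤ a i := fun i => (norm_nonneg _).trans (ha i 0)
  refine ⟨∑ i ∈ Finset.range (m + 1), (m.choose i : ℝ) * a i * (b (m - i) * 2 ^ (m - i)),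
    Finset.sum_nonneg fun i _ => mul_nonneg (mul_nonneg (Nat.cast_nonneg _) (ha0 i))
      (mul_nonneg (hb0 _).le (by positivity)), fun ε hε hε1 δ hδ x y hy => ?_⟩
  refine (mul_le_mul_of_nonneg_left (norm_iteratedFDeriv_kernel_le ψ ρ hε m x y)
    (by positivity)).trans ?_
  rw [Finset.mul_sum, Finset.sum_mul]
  refine Finset.sum_le_sum fun i _ => ?_
  by_cases hyt : y ∈ tsupport ψ
  · set w := ε⁻¹ • (x - y) with hw
    have hδw : δ ^ M ≤ ε ^ M * ‖w‖ ^ M := by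
      rw [← mul_pow]
      refine pow_le_pow_left₀ hδ ((hy hyt).trans (le_of_eq ?_)) _
      rw [hw, norm_smul, Real.norm_of_nonneg (by positivity), ← mul_assoc,
        mul_inv_cancel₀ hε.ne', one_mul]
    have hej : ε⁻¹ ^ (m - i) ≤ ε⁻¹ ^ m :=
      pow_le_pow_right₀ ((one_le_inv₀ hε).2 hε1) (Nat.sub_le _ _)
    calc δ ^ M * ((m.choose i : ℝ) * ‖iteratedFDeriv ℝ i ψ y‖ *
          ((ε ^ n)⁻¹ * ‖iteratedFDeriv ℝ (m - i) ρ w‖ * (2 * ε⁻¹) ^ (m - i)))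
        ≤ (ε ^ M * ‖w‖ ^ M) * ((m.choose i : ℝ) * a i *
          ((ε ^ n)⁻¹ * ‖iteratedFDeriv ℝ (m - i) ρ w‖ * (2 ^ (m - i) * ε⁻¹ ^ m))) := by
          rw [mul_pow]
          have := ha i y
          have := ha0 i
          gcongr
      _ = (‖w‖ ^ M * ‖iteratedFDeriv ℝ (m - i) ρ w‖) * ((m.choose i : ℝ) * a i * 2 ^ (m - i) *
          ((ε ^ n)⁻¹ * ε⁻¹ ^ m * ε ^ M)) := by ring
      _ ≤ b (m - i) * ((m.choose i : ℝ) * a i * 2 ^ (m - i) *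
          ((ε ^ n)⁻¹ * ε⁻¹ ^ m * ε ^ M)) := by
          have := ha0 i
          exact mul_le_mul_of_nonneg_right (hb _ _) (by positivity)
      _ = _ := by ring
  · have h0 : iteratedFDeriv ℝ i ψ y = 0 := by
      by_contra h
      exact hyt (support_iteratedFDeriv_subset i h)
    have := ha0 i
    have := (hb0 (m - i)).le
    rw [h0, norm_zero, mul_zero, zero_mul, mul_zero]
    positivity

lemma contDiff_regularize (ρ : SchwartzMap 𝔼 ℝ) (ψ : 𝓓(Ω, ℝ)) (T : 𝓓'(Ω, 𝕜)) (ε : I) :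
    ContDiff ℝ ∞ (regularize ρ ψ T ε) := by
  obtain ⟨N, C, hC, h⟩ :=
    exists_bound_apply_family T (tsupport ψ) ψ.hasCompactSupport.isCompact ψ.tsupport_subset
  exact (h (kernel ψ ρ ε) (contDiff_kernel ψ ρ ε) (support_kernel_subset ψ ρ ε)).1

/-- At distance at least `δ` from the support of the cut-off, the decay of `ρ` gains any power `M`
of `ε` over a fixed loss. The exponent `M = 0`, with `δ = 0`, gives moderateness. -/
lemma exists_regularize_bound (ρ : SchwartzMap 𝔼 ℝ) (ψ : 𝓓(Ω, ℝ)) (T : 𝓓'(Ω, 𝕜)) :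
    ∃ N : ℕ, ∀ p M : ℕ, ∃ C : ℝ, ∀ (ε : I) (δ : ℝ), 0 ≤ δ → 0 < δ ^ M → ∀ x : 𝔼,
      (∀ y ∈ tsupport ψ, δ ≤ ‖x - y‖) → ∀ k ≤ p,
      ‖iteratedFDeriv ℝ k (regularize ρ ψ T ε) x‖ ≤
        (δ ^ M)⁻¹ * C * (ε : ℝ) ^ ((M : ℝ) - (N + p : ℕ)) := by
  obtain ⟨N, C₀, hC₀, h⟩ :=
    exists_bound_apply_family T (tsupport ψ) ψ.hasCompactSupport.isCompact ψ.tsupport_subset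
  refine ⟨n + N, fun p M => ?_⟩
  choose C hC0 hC using fun m => exists_kernel_bound ψ ρ m M
  refine ⟨C₀ * ∑ m ∈ Finset.range (p + N + 1), C m, fun ε δ hδ hδM x hx k hk => ?_⟩
  have hε := ε.2.1
  have hS : 0 ≤ ∑ m ∈ Finset.range (p + N + 1), C m := Finset.sum_nonneg fun m _ => hC0 m
  have hpow : (ε : ℝ) ^ ((M : ℝ) - (n + N + p : ℕ)) =
      ((ε : ℝ) ^ n)⁻¹ * (ε : ℝ)⁻¹ ^ (p + N) * (ε : ℝ) ^ M := by
    rw [Real.rpow_sub hε, Real.rpow_natCast, Real.rpow_natCast, inv_pow, ← mul_inv, ← pow_add,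
      show n + (p + N) = n + N + p by ring]
    ring
  have key := (h (kernel ψ ρ ε) (contDiff_kernel ψ ρ ε) (support_kernel_subset ψ ρ ε)).2 k x
    ((δ ^ M)⁻¹ * (∑ m ∈ Finset.range (p + N + 1), C m) *
      (ε : ℝ) ^ ((M : ℝ) - (n + N + p : ℕ))) (by positivity) (fun y hy i hi => ?_)
  · refine key.trans (le_of_eq ?_)
    ring
  · have h1 := hC (k + i) ε hε ε.2.2 δ hδ x y fun hy => hx y hy
    rw [mul_assoc, ← div_eq_inv_mul, le_div_iff₀ hδM, mul_comm]
    refine h1.trans ?_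
    rw [hpow]
    have hm : k + i ∈ Finset.range (p + N + 1) := Finset.mem_range.2 (by omega)
    have h2 : C (k + i) ≤ ∑ m ∈ Finset.range (p + N + 1), C m :=
      Finset.single_le_sum (fun m _ => hC0 m) hm
    have h3 : (ε : ℝ)⁻¹ ^ (k + i) ≤ (ε : ℝ)⁻¹ ^ (p + N) :=
      pow_le_pow_right₀ ((one_le_inv₀ hε).2 ε.2.2) (by omega)
    gcongr

theorem isModerateOn_regularize (ρ : SchwartzMap 𝔼 ℝ) (ψ : 𝓓(Ω, ℝ)) (T : 𝓓'(Ω, 𝕜)) :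
    IsModerateOn (regularize ρ ψ T) Set.univ := by
  intro K _ _ p
  obtain ⟨N, h⟩ := exists_regularize_bound ρ ψ T
  obtain ⟨C, hC⟩ := h p 0
  refine ⟨N + p, C, 1, one_pos, fun ε _ k hk x _ => ?_⟩
  have := hC ε 0 le_rfl (by simp) x (fun y _ => norm_nonneg _) k hk
  simpa using this

/-- The regularisation is negligible where the cut-off vanishes. -/
theorem isNegligibleOn_regularize (ρ : SchwartzMap 𝔼 ℝ) (ψ : 𝓓(Ω, ℝ)) (T : 𝓓'(Ω, 𝕜)) {W : Set 𝔼}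
    (hW : IsOpen W) (h0 : ∀ y ∈ W, ψ y = 0) : IsNegligibleOn (regularize ρ ψ T) W := by
  intro K hKW hK p q
  obtain ⟨N, h⟩ := exists_regularize_bound ρ ψ T
  obtain ⟨C, hC⟩ := h p (q + (N + p))
  -- `K` has positive distance to the support of `ψ`, which lies outside `W`
  obtain ⟨δ, hδ, hδW⟩ := hK.exists_thickening_subset_open hW hKW
  refine ⟨(δ ^ (q + (N + p)))⁻¹ * C, 1, one_pos, fun ε _ k hk x hx => ?_⟩
  have hdist : ∀ y ∈ tsupport ψ, δ ≤ ‖x - y‖ := by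
    intro y hy
    by_contra! hlt
    have hyW : y ∈ W := hδW (Metric.mem_thickening_iff.2 ⟨x, hx, by
      rwa [dist_comm, dist_eq_norm]⟩)
    have hsub : tsupport ψ ⊆ Wᶜ :=
      closure_minimal (fun z hz hzW => hz (h0 z hzW)) hW.isClosed_compl
    exact hsub hy hyW
  have := hC ε δ hδ.le (by positivity) x hdist k hk
  convert this using 3
  push_cast
  ring

lemma regularize_sub (ρ : SchwartzMap 𝔼 ℝ) (ψ ψ' : 𝓓(Ω, ℝ)) (T : 𝓓'(Ω, 𝕜)) (ε : I) (x : 𝔼) :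
    regularize ρ (ψ - ψ') T ε x = regularize ρ ψ T ε x - regularize ρ ψ' T ε x := by
  have : kernel (ψ - ψ') ρ ε x = kernel ψ ρ ε x - kernel ψ' ρ ε x := by
    ext y
    exact sub_mul _ _ _
  rw [regularize, this]
  exact map_sub T _ _

end regularize

/-! ### Weak convergence of the regularisation -/

section weak

open MeasureTheory

variable {n : ℕ} {𝕜 : Type*} [RCLike 𝕜] {Ω : TopologicalSpace.Opens (EuclideanSpace ℝ (Fin n))}

local notation "𝔼" => EuclideanSpace ℝ (Fin n)

/-- The filter `ε → 0` on the index set `]0, 1]`. -/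
def toZero : Filter I := Filter.comap ((↑) : I → ℝ) (𝓝 0)

instance : toZero.NeBot := by
  refine mem_closure_iff_comap_neBot.1 ?_
  rw [closure_Ioc zero_ne_one]
  exact Set.left_mem_Icc.2 zero_le_one

instance : toZero.IsCountablyGenerated := by
  unfold toZero
  infer_instance

lemma tendsto_toZero : Filter.Tendsto ((↑) : I → ℝ) toZero (𝓝 0) := Filter.tendsto_comap

/-- The test function `y ↦ ψ(y) φ(y + h)`. -/
def shiftMul (ψ φ : 𝓓(Ω, ℝ)) (h : 𝔼) : 𝓓(Ω, ℝ) where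
  toFun := fun y => ψ y * φ (y + h)
  contDiff' := ψ.contDiff.mul (φ.contDiff.comp (contDiff_id.add contDiff_const))
  hasCompactSupport' := ψ.hasCompactSupport.mul_right
  tsupport_subset' := (tsupport_mul_subset_left (f := ψ)).trans ψ.tsupport_subset

lemma shiftMul_apply (ψ φ : 𝓓(Ω, ℝ)) (h y : 𝔼) : shiftMul ψ φ h y = ψ y * φ (y + h) := rfl

lemma contDiff_shiftMul (ψ φ : 𝓓(Ω, ℝ)) :
    ContDiff ℝ ∞ fun z : 𝔼 × 𝔼 => shiftMul ψ φ z.1 z.2 :=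
  (ψ.contDiff.comp contDiff_snd).mul (φ.contDiff.comp (contDiff_snd.add contDiff_fst))

lemma support_shiftMul_subset (ψ φ : 𝓓(Ω, ℝ)) (h : 𝔼) :
    Function.support (shiftMul ψ φ h) ⊆ tsupport ψ := fun y hy =>
  subset_tsupport _ fun h0 => hy (by rw [shiftMul_apply, h0, zero_mul])

lemma exists_compact_shiftMul_eq_zero (ψ φ : 𝓓(Ω, ℝ)) :
    ∃ K : Set 𝔼, IsCompact K ∧ ∀ h ∉ K, shiftMul ψ φ h = 0 := by
  refine ⟨(fun z : 𝔼 × 𝔼 => z.1 - z.2) '' (tsupport φ ×ˢ tsupport ψ),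
    (φ.hasCompactSupport.isCompact.prod ψ.hasCompactSupport.isCompact).image (by fun_prop),
    fun h hh => ?_⟩
  ext y
  by_contra hne
  have hne' : ψ y * φ (y + h) ≠ 0 := hne
  refine hh ⟨(y + h, y), ⟨subset_tsupport _ (right_ne_zero_of_mul hne'),
    subset_tsupport _ (left_ne_zero_of_mul hne')⟩, by simp⟩

/-- Pairing `(ψ T) * ρ_ε` with a test function amounts to averaging `T` over translations of the
test function: both sides are the value of `T` at the test function
`y ↦ ψ(y) ∫ φ(x) ρ_ε(x - y) dx`. -/
theorem integral_mul_regularize (ρ : SchwartzMap 𝔼 ℝ) (ψ φ : 𝓓(Ω, ℝ)) (T : 𝓓'(Ω, 𝕜)) (ε : I) :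
    ∫ x, φ x • regularize ρ ψ T ε x = ∫ z, ρ z • T (shiftMul ψ φ ((ε : ℝ) • z)) := by
  have hε := ε.2.1
  let r : 𝔼 → ℝ := fun h => ((ε : ℝ) ^ n)⁻¹ * ρ ((ε : ℝ)⁻¹ • h)
  have hr : ContDiff ℝ ∞ r := contDiff_const.mul ((ρ.smooth ⊤).comp (contDiff_id.const_smul _))
  let F₁ : 𝔼 → 𝓓(Ω, ℝ) := fun x => φ x • kernel ψ ρ ε x
  let F₂ : 𝔼 → 𝓓(Ω, ℝ) := fun h => r h • shiftMul ψ φ h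
  have hF₁ : ContDiff ℝ ∞ fun z : 𝔼 × 𝔼 => F₁ z.1 z.2 :=
    (φ.contDiff.comp contDiff_fst).mul (contDiff_kernel ψ ρ ε)
  have hF₂ : ContDiff ℝ ∞ fun z : 𝔼 × 𝔼 => F₂ z.1 z.2 :=
    (hr.comp contDiff_fst).mul (contDiff_shiftMul ψ φ)
  have hs₁ : ∀ x, Function.support (F₁ x) ⊆ tsupport ψ := fun x =>
    (Function.support_const_smul_subset _ _).trans (support_kernel_subset ψ ρ ε x)
  have hs₂ : ∀ h, Function.support (F₂ h) ⊆ tsupport ψ := fun h =>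
    (Function.support_const_smul_subset _ _).trans (support_shiftMul_subset ψ φ h)
  have h0₁ : ∀ x ∉ tsupport φ, ∀ y, F₁ x y = 0 := fun x hx y => by
    change φ x * kernel ψ ρ ε x y = 0
    rw [image_eq_zero_of_notMem_tsupport hx, zero_mul]
  obtain ⟨K₂, hK₂, hK₂0⟩ := exists_compact_shiftMul_eq_zero ψ φ
  have h0₂ : ∀ h ∉ K₂, ∀ y, F₂ h y = 0 := fun h hh y => by
    change r h * shiftMul ψ φ h y = 0
    rw [hK₂0 h hh]
    exact mul_zero _
  have hθs : Function.support (fun y => ∫ x, F₁ x y) ⊆ tsupport ψ := by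
    intro y hy
    by_contra hyK
    refine hy (integral_eq_zero_of_ae (Filter.Eventually.of_forall fun x => ?_))
    by_contra h
    exact hyK (hs₁ x h)
  have hθt : tsupport (fun y => ∫ x, F₁ x y) ⊆ tsupport ψ :=
    closure_minimal hθs (isClosed_tsupport _)
  let θ : 𝓓(Ω, ℝ) :=
    ⟨fun y => ∫ x, F₁ x y,
      (contDiff_integral_family hF₁ φ.hasCompactSupport.isCompact h0₁).1,
      ψ.hasCompactSupport.isCompact.of_isClosed_subset (isClosed_tsupport _) hθt,
      hθt.trans ψ.tsupport_subset⟩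
  -- the substitution `x = y + h` turns one family into the other
  have hθ₂ : ∀ y, θ y = ∫ h, F₂ h y := fun y => by
    change ∫ x, F₁ x y = _
    rw [← integral_add_left_eq_self (fun x => F₁ x y) y]
    refine integral_congr_ae (Filter.Eventually.of_forall fun h => ?_)
    change φ (y + h) * (ψ y * (((ε : ℝ) ^ n)⁻¹ * ρ ((ε : ℝ)⁻¹ • (y + h - y)))) =
      ((ε : ℝ) ^ n)⁻¹ * ρ ((ε : ℝ)⁻¹ • h) * (ψ y * φ (y + h))
    rw [add_sub_cancel_left]
    ring
  have e₁ := apply_integral_family T ψ.hasCompactSupport.isCompact ψ.tsupport_subset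
    φ.hasCompactSupport.isCompact F₁ hF₁ hs₁ h0₁ θ fun _ => rfl
  have e₂ := apply_integral_family T ψ.hasCompactSupport.isCompact ψ.tsupport_subset
    hK₂ F₂ hF₂ hs₂ h0₂ θ hθ₂
  have e₃ : ∫ x, φ x • regularize ρ ψ T ε x = ∫ x, T (F₁ x) :=
    integral_congr_ae (Filter.Eventually.of_forall fun x => (map_smul T _ _).symm)
  have e₄ : ∫ h, T (F₂ h) = ((ε : ℝ) ^ n)⁻¹ •
      ∫ h, ρ ((ε : ℝ)⁻¹ • h) • T (shiftMul ψ φ h) := by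
    rw [← integral_smul]
    refine integral_congr_ae (Filter.Eventually.of_forall fun h => ?_)
    refine (map_smul T (r h) (shiftMul ψ φ h)).trans ?_
    exact mul_smul _ _ _
  have e₅ := Measure.integral_comp_smul (volume : Measure 𝔼)
    (fun h => ρ ((ε : ℝ)⁻¹ • h) • T (shiftMul ψ φ h)) (ε : ℝ)
  rw [finrank_euclideanSpace_fin, abs_of_pos (by positivity)] at e₅
  rw [e₃, ← e₁, e₂, e₄, ← e₅]
  refine integral_congr_ae (Filter.Eventually.of_forall fun z => ?_)
  simp only [inv_smul_smul₀ hε.ne']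

/-- The regularisations of `ψ T` converge weakly to `ψ T`. -/
theorem tendsto_integral_mul_regularize {ρ : SchwartzMap 𝔼 ℝ} (hρ : ∫ x, ρ x = 1) (ψ φ : 𝓓(Ω, ℝ))
    (T : 𝓓'(Ω, 𝕜)) :
    Filter.Tendsto (fun ε : I => ∫ x, φ x • regularize ρ ψ T ε x) toZero
      (𝓝 (T (shiftMul ψ φ 0))) := by
  simp_rw [integral_mul_regularize]
  let g : 𝔼 → 𝕜 := fun h => T (shiftMul ψ φ h)
  obtain ⟨N, C, -, hN⟩ :=
    exists_bound_apply_family T (tsupport ψ) ψ.hasCompactSupport.isCompact ψ.tsupport_subset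
  have hg : Continuous g :=
    (hN (shiftMul ψ φ) (contDiff_shiftMul ψ φ) (support_shiftMul_subset ψ φ)).1.continuous
  obtain ⟨K, hK, hK0⟩ := exists_compact_shiftMul_eq_zero ψ φ
  obtain ⟨B, hB⟩ := hg.bounded_above_of_compact_support
    (HasCompactSupport.intro hK fun h hh => by
      change T (shiftMul ψ φ h) = 0
      rw [hK0 h hh]
      exact map_zero T)
  have hlim : ∫ z, ρ z • g 0 = T (shiftMul ψ φ 0) := by
    rw [integral_smul_const, hρ, one_smul]
  rw [← hlim]
  refine tendsto_integral_filter_of_dominated_convergence (fun z => ‖ρ z‖ * B)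
    (Filter.Eventually.of_forall fun ε => ?_) (Filter.Eventually.of_forall fun ε =>
      Filter.Eventually.of_forall fun z => ?_) (ρ.integrable.norm.mul_const B)
    (Filter.Eventually.of_forall fun z => ?_)
  · exact (ρ.continuous.smul (hg.comp (continuous_const_smul _))).aestronglyMeasurable
  · refine (norm_smul_le _ _).trans ?_
    exact mul_le_mul_of_nonneg_left (hB _) (norm_nonneg _)
  · have h1 : Filter.Tendsto (fun ε : I => (ε : ℝ) • z) toZero (𝓝 0) := by
      simpa using tendsto_toZero.smul_const z
    exact ((hg.tendsto 0).comp h1).const_smul (ρ z)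

end weak

/-! ### Calculus of nets -/

section nets

variable {n : ℕ} {𝕜 : Type*} [RCLike 𝕜] {Ω : TopologicalSpace.Opens (EuclideanSpace ℝ (Fin n))}
  {v w : I → EuclideanSpace ℝ (Fin n) → 𝕜} {K L U : Set (EuclideanSpace ℝ (Fin n))}
  {p : ℕ} {a : ℝ}

local notation "𝔼" => EuclideanSpace ℝ (Fin n)

lemma IsBigOn.subset (h : IsBigOn v K p a) (hL : L ⊆ K) : IsBigOn v L p a := by
  obtain ⟨C, η, hη, h⟩ := h
  exact ⟨C, η, hη, fun ε hε k hk x hx => h ε hε k hk x (hL hx)⟩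

lemma IsBigOn.congr (h : IsBigOn v K p a) (hU : IsOpen U) (hKU : K ⊆ U)
    (e : ∀ ε, ∀ x ∈ U, v ε x = w ε x) : IsBigOn w K p a := by
  obtain ⟨C, η, hη, h⟩ := h
  refine ⟨C, η, hη, fun ε hε k hk x hx => ?_⟩
  have h1 : v ε =ᶠ[𝓝 x] w ε :=
    Filter.eventually_of_mem (hU.mem_nhds (hKU hx)) fun y hy => e ε y hy
  rw [← (h1.iteratedFDeriv (𝕜 := ℝ) k).eq_of_nhds]
  exact h ε hε k hk x hx

lemma IsBigOn.add (hv' : ∀ ε, ∀ x ∈ K, ContDiffAt ℝ ∞ (v ε) x)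
    (hw' : ∀ ε, ∀ x ∈ K, ContDiffAt ℝ ∞ (w ε) x) (hv : IsBigOn v K p a) (hw : IsBigOn w K p a) :
    IsBigOn (fun ε x => v ε x + w ε x) K p a := by
  obtain ⟨C, η, hη, h⟩ := hv
  obtain ⟨C', η', hη', h'⟩ := hw
  refine ⟨C + C', min η η', lt_min hη hη', fun ε hε k hk x hx => ?_⟩
  have e : iteratedFDeriv ℝ k (fun x => v ε x + w ε x) x
      = iteratedFDeriv ℝ k (v ε) x + iteratedFDeriv ℝ k (w ε) x :=
    iteratedFDeriv_add_apply ((hv' ε x hx).of_le (by exact_mod_cast le_top))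
      ((hw' ε x hx).of_le (by exact_mod_cast le_top))
  rw [e, add_mul]
  exact (norm_add_le _ _).trans (add_le_add (h ε (hε.trans (min_le_left _ _)) k hk x hx)
    (h' ε (hε.trans (min_le_right _ _)) k hk x hx))

lemma IsBigOn.neg (hv : IsBigOn v K p a) : IsBigOn (fun ε x => -v ε x) K p a := by
  obtain ⟨C, η, hη, h⟩ := hv
  refine ⟨C, η, hη, fun ε hε k hk x hx => ?_⟩
  have e : iteratedFDeriv ℝ k (fun x => -v ε x) x = -iteratedFDeriv ℝ k (v ε) x :=
    iteratedFDeriv_neg_apply (f := v ε)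
  rw [e, norm_neg]
  exact h ε hε k hk x hx

lemma IsBigOn.zero : IsBigOn (fun _ _ => (0 : 𝕜)) K p a :=
  ⟨0, 1, one_pos, fun ε _ k _ x _ => by simp [iteratedFDeriv_fun_zero]⟩

lemma IsBigOn.sum {s : Finset ℕ} {V : ℕ → I → 𝔼 → 𝕜} (hV : ∀ i ε, ContDiff ℝ ∞ (V i ε))
    (h : ∀ i ∈ s, IsBigOn (V i) K p a) : IsBigOn (fun ε x => ∑ i ∈ s, V i ε x) K p a := by
  classical
  induction s using Finset.induction_on with
  | empty => simpa using IsBigOn.zero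
  | insert i s hi ih =>
    simp only [Finset.sum_insert hi]
    refine IsBigOn.add (fun ε x _ => (hV i ε).contDiffAt)
      (fun ε x _ => (ContDiff.sum fun i _ => hV i ε).contDiffAt)
      (h i (Finset.mem_insert_self _ _)) (ih fun j hj => h j (Finset.mem_insert_of_mem hj))

/-- Multiplication by a fixed smooth function `χ` preserves `O`-estimates; these are needed only on
the support of `χ`. -/
lemma IsBigOn.smul_left {χ : 𝔼 → ℝ} (hχ : ContDiff ℝ ∞ χ) (hv' : ∀ ε, ContDiff ℝ ∞ (v ε))
    (hK : IsCompact K) (hv : IsBigOn v (K ∩ tsupport χ) p a) :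
    IsBigOn (fun ε x => χ x • v ε x) K p a := by
  obtain ⟨C, η, hη, h⟩ := hv
  have hb : ∀ k : ℕ, ∃ A : ℝ, ∀ x ∈ K, ‖iteratedFDeriv ℝ k χ x‖ ≤ A := fun k =>
    hK.exists_bound_of_continuousOn (continuous_iteratedFDeriv_of_smooth hχ k).continuousOn
  choose A hA using hb
  refine ⟨∑ k ∈ Finset.range (p + 1), ∑ i ∈ Finset.range (k + 1), (k.choose i : ℝ) * |A i| * |C|,
    η, hη, fun ε hε k hk x hx => ?_⟩
  have hpos : 0 ≤ (ε : ℝ) ^ a := Real.rpow_nonneg ε.2.1.le _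
  by_cases hxχ : x ∈ tsupport χ
  · refine (norm_iteratedFDeriv_smul_le hχ (hv' ε) x (n := k) (by exact_mod_cast le_top)).trans ?_
    have h1 : ∑ i ∈ Finset.range (k + 1), (k.choose i : ℝ) * ‖iteratedFDeriv ℝ i χ x‖
        * ‖iteratedFDeriv ℝ (k - i) (v ε) x‖
        ≤ (∑ i ∈ Finset.range (k + 1), (k.choose i : ℝ) * |A i| * |C|) * (ε : ℝ) ^ a := by
      rw [Finset.sum_mul]
      refine Finset.sum_le_sum fun i _ => ?_
      rw [mul_assoc _ |C|]
      refine mul_le_mul (mul_le_mul_of_nonneg_left ((hA i x hx).trans (le_abs_self _))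
        (Nat.cast_nonneg _)) ?_ (norm_nonneg _) (by positivity)
      exact (h ε hε (k - i) ((Nat.sub_le _ _).trans hk) x ⟨hx, hxχ⟩).trans
        (mul_le_mul_of_nonneg_right (le_abs_self _) hpos)
    refine h1.trans (mul_le_mul_of_nonneg_right ?_ hpos)
    exact Finset.single_le_sum (f := fun k : ℕ => ∑ i ∈ Finset.range (k + 1),
      (k.choose i : ℝ) * |A i| * |C|) (fun _ _ => Finset.sum_nonneg fun _ _ => by positivity)
      (Finset.mem_range.2 (Nat.lt_succ_iff.2 hk))
  · have h0 : (fun x => χ x • v ε x) =ᶠ[𝓝 x] fun _ => (0 : 𝕜) := by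
      filter_upwards [notMem_tsupport_iff_eventuallyEq.1 hxχ] with y hy
      simp [hy]
    rw [(h0.iteratedFDeriv (𝕜 := ℝ) k).eq_of_nhds, iteratedFDeriv_fun_zero]
    simp only [Pi.zero_apply, norm_zero]
    exact mul_nonneg (Finset.sum_nonneg fun _ _ => Finset.sum_nonneg fun _ _ => by positivity) hpos

lemma IsBigOn.const_smul (c : 𝕜) (hv' : ∀ ε, ∀ x ∈ K, ContDiffAt ℝ ∞ (v ε) x)
    (hv : IsBigOn v K p a) : IsBigOn (fun ε x => c • v ε x) K p a := by
  obtain ⟨C, η, hη, h⟩ := hv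
  refine ⟨‖c‖ * C, η, hη, fun ε hε k hk x hx => ?_⟩
  have e : iteratedFDeriv ℝ k (fun x => c • v ε x) x = c • iteratedFDeriv ℝ k (v ε) x :=
    iteratedFDeriv_const_smul_apply' ((hv' ε x hx).of_le (by exact_mod_cast le_top))
  rw [e, norm_smul, mul_assoc]
  exact mul_le_mul_of_nonneg_left (h ε hε k hk x hx) (norm_nonneg _)

lemma IsNegligibleOn.subset {U' : Set 𝔼} (h : IsNegligibleOn v U) (hU : U' ⊆ U) :
    IsNegligibleOn v U' :=
  fun K hK hc p q => h K (hK.trans hU) hc p q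

lemma IsNegligibleOn.congr (h : IsNegligibleOn v U) (hU : IsOpen U)
    (e : ∀ ε, ∀ x ∈ U, v ε x = w ε x) : IsNegligibleOn w U :=
  fun K hK hc p q => (h K hK hc p q).congr hU hK e

lemma IsNegligibleOn.add (hv' : ∀ ε, ∀ x ∈ U, ContDiffAt ℝ ∞ (v ε) x)
    (hw' : ∀ ε, ∀ x ∈ U, ContDiffAt ℝ ∞ (w ε) x) (hv : IsNegligibleOn v U)
    (hw : IsNegligibleOn w U) : IsNegligibleOn (fun ε x => v ε x + w ε x) U :=
  fun K hK hc p q => IsBigOn.add (fun ε x hx => hv' ε x (hK hx)) (fun ε x hx => hw' ε x (hK hx))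
    (hv K hK hc p q) (hw K hK hc p q)

lemma IsNegligibleOn.neg (hv : IsNegligibleOn v U) : IsNegligibleOn (fun ε x => -v ε x) U :=
  fun K hK hc p q => (hv K hK hc p q).neg

lemma IsNegligibleOn.sub (hv' : ∀ ε, ∀ x ∈ U, ContDiffAt ℝ ∞ (v ε) x)
    (hw' : ∀ ε, ∀ x ∈ U, ContDiffAt ℝ ∞ (w ε) x) (hv : IsNegligibleOn v U)
    (hw : IsNegligibleOn w U) : IsNegligibleOn (fun ε x => v ε x - w ε x) U := by
  simp only [sub_eq_add_neg]
  exact hv.add hv' (fun ε x hx => (hw' ε x hx).neg) hw.neg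

lemma IsNegligibleOn.const_smul (c : 𝕜) (hv' : ∀ ε, ∀ x ∈ U, ContDiffAt ℝ ∞ (v ε) x)
    (hv : IsNegligibleOn v U) : IsNegligibleOn (fun ε x => c • v ε x) U :=
  fun K hK hc p q => (hv K hK hc p q).const_smul c fun ε x hx => hv' ε x (hK hx)

lemma extNet_apply (u : I → smooth 𝕜 Ω) (ε : I) {x : 𝔼} (hx : x ∈ Ω) :
    extNet u ε x = (u ε : Ω → 𝕜) ⟨x, hx⟩ := ext_of_mem _ hx

lemma contDiffAt_extNet (u : I → smooth 𝕜 Ω) (ε : I) {x : 𝔼} (hx : x ∈ Ω) :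
    ContDiffAt ℝ ∞ (extNet u ε) x :=
  ((u ε).2 : ContDiffOn ℝ ∞ (ext (u ε : Ω → 𝕜)) Ω).contDiffAt (Ω.isOpen.mem_nhds hx)

end nets

/-! ### Gluing nets along an exhaustion -/

section gluing

variable {n : ℕ} {𝕜 : Type*} [RCLike 𝕜] {Ω : TopologicalSpace.Opens (EuclideanSpace ℝ (Fin n))}

local notation "𝔼" => EuclideanSpace ℝ (Fin n)

lemma exists_cutoff {K : Set 𝔼} (hK : IsCompact K) (hKΩ : K ⊆ Ω) :
    ∃ η : 𝓓(Ω, ℝ), ∀ᶠ y in 𝓝ˢ K, η y = 1 := by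
  obtain ⟨L, hL, hKL, hLΩ⟩ := exists_compact_between hK Ω.isOpen hKΩ
  obtain ⟨f, h1, h0, -⟩ := exists_contMDiffMap_one_nhds_of_subset_interior
    (modelWithCornersSelf ℝ 𝔼) (n := ⊤) hK.isClosed hKL
  have hs : tsupport f ⊆ L := closure_minimal
    (fun x hx => by_contra fun h => hx (h0 x h)) hL.isClosed
  exact ⟨⟨f, f.contMDiff.contDiff, hL.of_isClosed_subset (isClosed_tsupport _) hs,
    hs.trans hLΩ⟩, h1⟩

lemma Exhaustion.exists_subset (X : Exhaustion Ω) {K : Set 𝔼} (hK : IsCompact K) (hKΩ : K ⊆ Ω) :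
    ∃ m, K ⊆ X.set m :=
  hK.elim_directed_cover X.set X.isOpen (by rw [X.iUnion_eq]; exact hKΩ) X.mono.directed_le

lemma Exhaustion.subset (X : Exhaustion Ω) (m : ℕ) : X.set m ⊆ Ω :=
  subset_closure.trans (X.closure_subset m)

lemma Exhaustion.exists_cutoffs (X : Exhaustion Ω) :
    ∃ η : ℕ → 𝓓(Ω, ℝ), ∀ m, ∀ᶠ y in 𝓝ˢ (closure (X.set m)), η m y = 1 := by
  choose η hη using fun m => exists_cutoff (X.isCompact_closure m) (X.closure_subset m)
  exact ⟨η, hη⟩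

/-- A smooth partition of unity adapted to an exhaustion, by the differences of consecutive
cut-offs; the functions need not be nonnegative. -/
lemma Exhaustion.exists_partition (X : Exhaustion Ω) :
    ∃ χ : ℕ → 𝓓(Ω, ℝ), (∀ M m, M < m → ∀ x ∈ X.set M, χ m x = 0) ∧
      ∀ M, ∀ x ∈ X.set M, ∑ m ∈ Finset.range (M + 1), χ m x = 1 := by
  obtain ⟨η, hη⟩ := X.exists_cutoffs
  have h1 : ∀ m, ∀ x ∈ X.set m, η m x = 1 := fun m x hx =>
    (hη m).self_of_nhdsSet x (subset_closure hx)
  let χ : ℕ → 𝓓(Ω, ℝ) := fun m => Nat.casesOn m (η 0) fun k => η (k + 1) - η k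
  have hχ : ∀ k x, χ (k + 1) x = η (k + 1) x - η k x := fun k x => rfl
  refine ⟨χ, fun M m hm x hx => ?_, fun M x hx => ?_⟩
  · obtain ⟨k, rfl⟩ : ∃ k, m = k + 1 := ⟨m - 1, by omega⟩
    rw [hχ, h1 _ x (X.mono (by omega) hx), h1 _ x (X.mono (by omega) hx), sub_self]
  · have h2 : ∀ M, ∑ m ∈ Finset.range (M + 1), χ m x = η M x := by
      intro M
      induction M with
      | zero => simp [χ]
      | succ M ih => rw [Finset.sum_range_succ, ih, hχ, add_sub_cancel]
    rw [h2, h1 M x hx]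

/-- Moderate nets on the sets of an exhaustion that agree up to negligible nets come from a single
moderate net: the sheaf property of the Colombeau algebra, in the special case needed here. -/
theorem exists_glue (X : Exhaustion Ω) {w : ℕ → I → 𝔼 → 𝕜} (hw : ∀ m ε, ContDiff ℝ ∞ (w m ε))
    (hmod : ∀ m, IsModerateOn (w m) Set.univ)
    (hneg : ∀ m l, IsNegligibleOn (fun ε x => w m ε x - w l ε x) (X.set m ∩ X.set l)) :
    ∃ u : moderate 𝕜 Ω, ∀ m,
      IsNegligibleOn (fun ε x => extNet (u : I → smooth 𝕜 Ω) ε x - w m ε x) (X.set m) := by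
  obtain ⟨χ, hχ0, hχ1⟩ := X.exists_partition
  -- `w (s m)` carries the right information on the whole support of `χ m`
  choose s hs using fun m => X.exists_subset (χ m).hasCompactSupport (χ m).tsupport_subset
  let g : I → 𝔼 → 𝕜 := fun ε x => ∑ᶠ m, χ m x • w (s m) ε x
  have hg : ∀ M ε, ∀ x ∈ X.set M,
      g ε x = ∑ m ∈ Finset.range (M + 1), χ m x • w (s m) ε x := by
    intro M ε x hx
    refine finsum_eq_sum_of_support_subset _ fun m hm => ?_
    by_contra h
    simp only [Finset.coe_range, Set.mem_Iio, not_lt] at h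
    exact hm (by simp [hχ0 M m (by omega) x hx])
  have hsum : ∀ M ε, ContDiff ℝ ∞ fun x => ∑ m ∈ Finset.range (M + 1), χ m x • w (s m) ε x :=
    fun M ε => ContDiff.sum fun m _ => (χ m).contDiff.smul (hw (s m) ε)
  have hgΩ : ∀ ε, ContDiffOn ℝ ∞ (ext fun x : Ω => g ε x) Ω := by
    intro ε x hx
    obtain ⟨M, hM⟩ : ∃ M, x ∈ X.set M := by simpa [← X.iUnion_eq] using hx
    refine ContDiffAt.contDiffWithinAt ((hsum M ε).contDiffAt.congr_of_eventuallyEq ?_)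
    filter_upwards [(X.isOpen M).mem_nhds hM] with y hy
    rw [ext_of_mem _ (X.subset M hy), hg M ε y hy]
  let u : I → smooth 𝕜 Ω := fun ε => ⟨fun x => g ε x, hgΩ ε⟩
  have hu : ∀ M ε, ∀ x ∈ X.set M,
      extNet u ε x = ∑ m ∈ Finset.range (M + 1), χ m x • w (s m) ε x := fun M ε x hx =>
    (extNet_apply u ε (X.subset M hx)).trans (hg M ε x hx)
  have hmod' : IsModerateOn (extNet u) Ω := by
    intro K hK hc p
    obtain ⟨M, hM⟩ := X.exists_subset hc hK
    choose N hN using fun m => hmod (s m) K (Set.subset_univ _) hc p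
    refine ⟨∑ m ∈ Finset.range (M + 1), N m, ?_⟩
    refine (IsBigOn.sum (s := Finset.range (M + 1)) (V := fun m ε x => χ m x • w (s m) ε x)
      (fun m ε => (χ m).contDiff.smul (hw (s m) ε)) fun m hm => ?_).congr (X.isOpen M) hM
      fun ε x hx => (hu M ε x hx).symm
    refine IsBigOn.smul_left (χ m).contDiff (hw _) hc
      (((hN m).mono ?_).subset Set.inter_subset_left)
    rw [neg_le_neg_iff]
    exact_mod_cast Finset.single_le_sum (f := N) (fun _ _ => Nat.zero_le _) hm
  refine ⟨⟨u, hmod'⟩, fun M K hK hc p q => ?_⟩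
  refine (IsBigOn.sum (s := Finset.range (M + 1))
    (V := fun m ε x => χ m x • (w (s m) ε x - w M ε x))
    (fun m ε => (χ m).contDiff.smul ((hw (s m) ε).sub (hw M ε))) fun m _ => ?_).congr
    (X.isOpen M) hK fun ε x hx => ?_
  · refine IsBigOn.smul_left (χ m).contDiff (fun ε => (hw (s m) ε).sub (hw M ε)) hc
      (hneg (s m) M _ (fun x hx => ⟨hs m hx.2, hK hx.1⟩) ?_ p q)
    exact hc.inter_right (isClosed_tsupport _)
  -- on `X.set M` the functions `χ m` sum to one, so `w M` is the sum of the `χ m • w M`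
  · simp only [smul_sub, Finset.sum_sub_distrib]
    rw [← Finset.sum_smul, hχ1 M x hx, one_smul]
    exact congrArg (· - w M ε x) (hu M ε x hx).symm

end gluing

/-! ### The canonical embedding -/

section embedding

variable {n : ℕ} {𝕜 : Type*} [RCLike 𝕜] {Ω : TopologicalSpace.Opens (EuclideanSpace ℝ (Fin n))}
  {X : Exhaustion Ω} {η : ℕ → 𝓓(Ω, ℝ)} {ρ : SchwartzMap (EuclideanSpace ℝ (Fin n)) ℝ}
  {S T : 𝓓'(Ω, 𝕜)} {u v : moderate 𝕜 Ω}

local notation "𝔼" => EuclideanSpace ℝ (Fin n)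

lemma mk_surjective : Function.Surjective (mk : moderate 𝕜 Ω →ₐ[𝕜] Gen 𝕜 Ω) :=
  Ideal.Quotient.mk_surjective

lemma extNet_add_apply (u v : I → smooth 𝕜 Ω) (ε : I) (x : 𝔼) :
    extNet (u + v) ε x = extNet u ε x + extNet v ε x := congrFun (ext_add _ _) x

lemma extNet_sub_apply (u v : I → smooth 𝕜 Ω) (ε : I) (x : 𝔼) :
    extNet (u - v) ε x = extNet u ε x - extNet v ε x := by
  by_cases h : x ∈ Ω <;> simp [extNet, ext, h]

lemma extNet_smul_apply (c : 𝕜) (u : I → smooth 𝕜 Ω) (ε : I) (x : 𝔼) :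
    extNet (c • u) ε x = c • extNet u ε x := by
  by_cases h : x ∈ Ω <;> simp [extNet, ext, h]

lemma mk_eq_mk_iff : mk u = mk v ↔ IsNegligibleOn (fun ε x =>
    extNet (u : I → smooth 𝕜 Ω) ε x - extNet (v : I → smooth 𝕜 Ω) ε x) Ω := by
  have e : (fun ε x => extNet (u : I → smooth 𝕜 Ω) ε x - extNet (v : I → smooth 𝕜 Ω) ε x)
      = extNet ((u - v : moderate 𝕜 Ω) : I → smooth 𝕜 Ω) := by
    funext ε x
    exact (extNet_sub_apply _ _ ε x).symm
  rw [e]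
  exact Ideal.Quotient.eq (I := negligible 𝕜 Ω)

/-- The net `u` represents the embedded distribution `T`: on the `m`-th set of the exhaustion it
agrees, up to a negligible net, with the regularisation of `η m • T`. -/
def Represents (X : Exhaustion Ω) (η : ℕ → 𝓓(Ω, ℝ)) (ρ : SchwartzMap 𝔼 ℝ) (T : 𝓓'(Ω, 𝕜))
    (u : moderate 𝕜 Ω) : Prop :=
  ∀ m, IsNegligibleOn
    (fun ε x => extNet (u : I → smooth 𝕜 Ω) ε x - regularize ρ (η m) T ε x) (X.set m)

/-- Regularisations with two cut-offs that agree on `W` differ by a negligible net on `W`. -/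
lemma isNegligibleOn_regularize_sub (ρ : SchwartzMap 𝔼 ℝ) {ψ ψ' : 𝓓(Ω, ℝ)} (T : 𝓓'(Ω, 𝕜))
    {W : Set 𝔼} (hW : IsOpen W) (h : ∀ y ∈ W, ψ y = ψ' y) :
    IsNegligibleOn (fun ε x => regularize ρ ψ T ε x - regularize ρ ψ' T ε x) W :=
  (isNegligibleOn_regularize ρ (ψ - ψ') T hW fun y hy => sub_eq_zero.2 (h y hy)).congr hW
    fun ε x _ => regularize_sub ρ ψ ψ' T ε x

lemma exists_represents (hη : ∀ m, ∀ x ∈ X.set m, η m x = 1) (ρ : SchwartzMap 𝔼 ℝ)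
    (T : 𝓓'(Ω, 𝕜)) : ∃ u, Represents X η ρ T u :=
  exists_glue X (fun m ε => contDiff_regularize ρ (η m) T ε)
    (fun m => isModerateOn_regularize ρ (η m) T)
    fun m l => isNegligibleOn_regularize_sub ρ T ((X.isOpen m).inter (X.isOpen l))
      fun y hy => (hη m y hy.1).trans (hη l y hy.2).symm

lemma contDiffAt_extNet_sub_regularize (u : moderate 𝕜 Ω) (ρ : SchwartzMap 𝔼 ℝ) (ψ : 𝓓(Ω, ℝ))
    (T : 𝓓'(Ω, 𝕜)) (ε : I) {x : 𝔼} (hx : x ∈ Ω) :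
    ContDiffAt ℝ ∞ (fun x => extNet (u : I → smooth 𝕜 Ω) ε x - regularize ρ ψ T ε x) x :=
  (contDiffAt_extNet _ ε hx).sub (contDiff_regularize ρ ψ T ε).contDiffAt

lemma Represents.mk_eq_mk (hu : Represents X η ρ T u) (hv : Represents X η ρ T v) :
    mk u = mk v := by
  rw [mk_eq_mk_iff]
  intro K hK hc p q
  obtain ⟨m, hm⟩ := X.exists_subset hc hK
  refine (((hu m).sub ?_ ?_ (hv m)).congr (X.isOpen m) fun ε x _ => ?_) K hm hc p q
  · exact fun ε x hx => contDiffAt_extNet_sub_regularize u ρ _ T ε (X.subset m hx)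
  · exact fun ε x hx => contDiffAt_extNet_sub_regularize v ρ _ T ε (X.subset m hx)
  · exact sub_sub_sub_cancel_right _ _ _

lemma Represents.of_mk_eq (hu : Represents X η ρ T u) (h : mk v = mk u) :
    Represents X η ρ T v := by
  intro m
  refine (((mk_eq_mk_iff.1 h).subset (X.subset m)).add ?_ ?_ (hu m)).congr (X.isOpen m)
    fun ε x _ => ?_
  · exact fun ε x hx => (contDiffAt_extNet _ ε (X.subset m hx)).sub
      (contDiffAt_extNet _ ε (X.subset m hx))
  · exact fun ε x hx => contDiffAt_extNet_sub_regularize u ρ _ T ε (X.subset m hx)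
  · exact sub_add_sub_cancel _ _ _

lemma Represents.add (hu : Represents X η ρ S u) (hv : Represents X η ρ T v) :
    Represents X η ρ (S + T) (u + v) := by
  intro m
  refine ((hu m).add ?_ ?_ (hv m)).congr (X.isOpen m) fun ε x _ => ?_
  · exact fun ε x hx => contDiffAt_extNet_sub_regularize u ρ _ S ε (X.subset m hx)
  · exact fun ε x hx => contDiffAt_extNet_sub_regularize v ρ _ T ε (X.subset m hx)
  · have h1 : regularize ρ (η m) (S + T) ε x
      = regularize ρ (η m) S ε x + regularize ρ (η m) T ε x := rfl
    have h2 : extNet ((u + v : moderate 𝕜 Ω) : I → smooth 𝕜 Ω) ε x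
      = extNet (u : I → smooth 𝕜 Ω) ε x + extNet (v : I → smooth 𝕜 Ω) ε x :=
      extNet_add_apply _ _ ε x
    rw [h1, h2]
    ring

lemma Represents.smul (c : 𝕜) (hu : Represents X η ρ T u) :
    Represents X η ρ (c • T) (c • u) := by
  intro m
  refine ((hu m).const_smul c ?_).congr (X.isOpen m) fun ε x _ => ?_
  · exact fun ε x hx => contDiffAt_extNet_sub_regularize u ρ _ T ε (X.subset m hx)
  · have h1 : regularize ρ (η m) (c • T) ε x = c • regularize ρ (η m) T ε x := rfl
    have h2 : extNet ((c • u : moderate 𝕜 Ω) : I → smooth 𝕜 Ω) ε x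
      = c • extNet (u : I → smooth 𝕜 Ω) ε x := extNet_smul_apply _ _ ε x
    rw [h1, h2, smul_sub]

lemma Represents.isNegligibleOn (hη : ∀ m, ∀ x ∈ X.set m, η m x = 1)
    (hu : Represents X η ρ T u) {W : Set 𝔼} (hW : IsOpen W) (hWΩ : W ⊆ Ω) {ψ : 𝓓(Ω, ℝ)}
    (hψ : ∀ x ∈ W, ψ x = 1) :
    IsNegligibleOn (fun ε x => extNet (u : I → smooth 𝕜 Ω) ε x - regularize ρ ψ T ε x) W := by
  intro K hK hc p q
  obtain ⟨m, hm⟩ := X.exists_subset hc (hK.trans hWΩ)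
  have h1 := isNegligibleOn_regularize_sub (ψ := η m) (ψ' := ψ) ρ T ((X.isOpen m).inter hW)
    fun y hy => (hη m y hy.1).trans (hψ y hy.2).symm
  refine ((((hu m).subset Set.inter_subset_left).add ?_ ?_ h1).congr ((X.isOpen m).inter hW)
    fun ε x _ => ?_) K (Set.subset_inter hm hK) hc p q
  · exact fun ε x hx => contDiffAt_extNet_sub_regularize u ρ _ T ε (X.subset m hx.1)
  · exact fun ε x _ => ((contDiff_regularize ρ _ T ε).sub (contDiff_regularize ρ _ T ε)).contDiffAt
  · exact sub_add_sub_cancel _ _ _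

/-- The canonical embedding belonging to the mollifier `ρ`, built from a family of cut-offs along
an exhaustion. -/
def embedding (hη : ∀ m, ∀ x ∈ X.set m, η m x = 1) (ρ : SchwartzMap 𝔼 ℝ) :
    𝓓'(Ω, 𝕜) →ₗ[𝕜] Gen 𝕜 Ω where
  toFun T := mk (exists_represents hη ρ T).choose
  map_add' S T := by
    rw [← map_add mk]
    exact (exists_represents hη ρ _).choose_spec.mk_eq_mk
      ((exists_represents hη ρ S).choose_spec.add (exists_represents hη ρ T).choose_spec)
  map_smul' c T := by
    rw [RingHom.id_apply, ← map_smul mk]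
    exact (exists_represents hη ρ _).choose_spec.mk_eq_mk
      ((exists_represents hη ρ T).choose_spec.smul c)

lemma mk_eq_embedding_iff (hη : ∀ m, ∀ x ∈ X.set m, η m x = 1) :
    mk u = embedding hη ρ T ↔ Represents X η ρ T u :=
  ⟨fun h => (exists_represents hη ρ T).choose_spec.of_mk_eq h,
    fun h => h.mk_eq_mk (exists_represents hη ρ T).choose_spec⟩

theorem isCanonicalEmbedding_iff (hη : ∀ m, ∀ᶠ y in 𝓝ˢ (closure (X.set m)), η m y = 1)
    (hη' : ∀ m, ∀ x ∈ X.set m, η m x = 1) (ι : 𝓓'(Ω, 𝕜) → Gen 𝕜 Ω) :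
    IsCanonicalEmbedding ρ ι ↔ ι = embedding hη' ρ := by
  constructor
  · intro h
    funext T
    obtain ⟨u, hu⟩ := mk_surjective (ι T)
    rw [← hu, mk_eq_embedding_iff]
    exact fun m => (h T u hu (X.set m) (X.isOpen m) (X.isCompact_closure m) (X.closure_subset m)
      (η m) (hη m)).2
  · rintro rfl T u hu W hW - hWΩ ψ hψ
    refine ⟨fun ε => (contDiff_regularize ρ ψ T ε).contDiffOn, ?_⟩
    exact ((mk_eq_embedding_iff hη').1 hu).isNegligibleOn hη' hW (subset_closure.trans hWΩ)
      fun x hx => hψ.self_of_nhdsSet x (subset_closure hx)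

/-- A distribution represented by a net that tends to zero, at a positive power rate on every set of
the exhaustion, is zero: it is the weak limit of its regularisations. -/
theorem Represents.eq_zero (hη : ∀ m, ∀ x ∈ X.set m, η m x = 1) (hρ : ∫ x, ρ x = 1)
    (hu : Represents X η ρ T u)
    (h : ∀ m, ∃ a : ℝ, 0 < a ∧ ∃ v : moderate 𝕜 Ω, mk v = mk u ∧
      IsLittleOn (extNet (v : I → smooth 𝕜 Ω)) (X.set m) m a) : T = 0 := by
  ext φ
  obtain ⟨m, hm⟩ := X.exists_subset φ.hasCompactSupport φ.tsupport_subset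
  obtain ⟨a, ha, v, hvu, hv⟩ := h m
  obtain ⟨C, δ, hδ, hC⟩ := hu.of_mk_eq hvu m _ hm φ.hasCompactSupport 0 1
  obtain ⟨δ', hδ', hv⟩ := hv 1 one_pos
  have hφ : shiftMul (η m) φ 0 = φ := by
    ext y
    rw [shiftMul_apply, add_zero]
    by_cases hy : y ∈ tsupport φ
    · rw [hη m y (hm hy), one_mul]
    · rw [image_eq_zero_of_notMem_tsupport hy, mul_zero]
  have h1 := tendsto_integral_mul_regularize hρ (η m) φ T
  -- the limit of the integrals is `T φ`, since `η m = 1` on the support of `φ`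
  rw [hφ] at h1
  -- on the support of `φ` the regularisation is the sum of a net `O(ε ^ a)` and a negligible one
  have hbound : ∀ᶠ ε in toZero, ‖∫ x, φ x • regularize ρ (η m) T ε x‖
      ≤ ∫ x, ‖φ x‖ * ((ε : ℝ) ^ a + C * (ε : ℝ)) := by
    filter_upwards [tendsto_toZero.eventually_lt_const (lt_min hδ hδ')] with ε hε
    refine MeasureTheory.norm_integral_le_of_norm_le
      ((φ.contDiff.continuous.integrable_of_hasCompactSupport φ.hasCompactSupport).norm.mul_const _)
      (Filter.Eventually.of_forall fun x => ?_)
    rw [norm_smul]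
    by_cases hx : x ∈ tsupport φ
    · refine mul_le_mul_of_nonneg_left ?_ (norm_nonneg _)
      have h2 := hv ε (hε.le.trans (min_le_right _ _)) 0 (Nat.zero_le _) x (hm hx)
      have h3 := hC ε (hε.le.trans (min_le_left _ _)) 0 le_rfl x hx
      rw [norm_iteratedFDeriv_zero] at h2 h3
      rw [one_mul] at h2
      rw [Nat.cast_one, Real.rpow_one] at h3
      calc _ = ‖extNet (v : I → smooth 𝕜 Ω) ε x
            - (extNet (v : I → smooth 𝕜 Ω) ε x - regularize ρ (η m) T ε x)‖ := by
            rw [sub_sub_cancel]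
        _ ≤ _ := (norm_sub_le _ _).trans (add_le_add h2 h3)
    · simp [image_eq_zero_of_notMem_tsupport hx]
  have h2 : Filter.Tendsto (fun ε : I => ∫ x, ‖φ x‖ * ((ε : ℝ) ^ a + C * (ε : ℝ))) toZero
      (𝓝 0) := by
    simp only [MeasureTheory.integral_mul_const]
    have h3 : Filter.Tendsto (fun ε : I => (ε : ℝ) ^ a + C * (ε : ℝ)) toZero (𝓝 (0 + C * 0)) := by
      refine Filter.Tendsto.add ?_ (tendsto_toZero.const_mul C)
      have := (Real.continuousAt_rpow_const 0 a (Or.inr ha.le)).tendsto.comp tendsto_toZero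
      rwa [Real.zero_rpow ha.ne'] at this
    simpa using h3.const_mul (∫ x, ‖φ x‖)
  have h4 := squeeze_zero_norm' hbound h2
  exact tendsto_nhds_unique h1 h4

end embedding

/-! ### The sharp topology -/

section metric

variable {n : ℕ} {𝕜 : Type*} [RCLike 𝕜] {Ω : TopologicalSpace.Opens (EuclideanSpace ℝ (Fin n))}
  {X : Exhaustion Ω}

local notation "𝔼" => EuclideanSpace ℝ (Fin n)

lemma IsBigOn.isLittleOn {v : I → 𝔼 → 𝕜} {K : Set 𝔼} {p : ℕ} {a b : ℝ} (h : IsBigOn v K p a)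
    (hab : b < a) : IsLittleOn v K p b := by
  obtain ⟨C, η, hη, h⟩ := h
  intro c hc
  have hr : 0 < c / (|C| + 1) := by positivity
  -- with this bound on `ε`, one has `ε ^ (a - b) ≤ c / (|C| + 1)`
  refine ⟨min η ((c / (|C| + 1)) ^ (a - b)⁻¹), lt_min hη (Real.rpow_pos_of_pos hr _),
    fun ε hε k hk x hx => (h ε (hε.trans (min_le_left _ _)) k hk x hx).trans ?_⟩
  have hε0 : (0 : ℝ) < ε := ε.2.1
  have h1 : (ε : ℝ) ^ (a - b) ≤ c / (|C| + 1) := by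
    refine (Real.rpow_le_rpow hε0.le (hε.trans (min_le_right _ _)) (sub_pos.2 hab).le).trans ?_
    rw [Real.rpow_inv_rpow hr.le (sub_pos.2 hab).ne']
  have h2 : C * (ε : ℝ) ^ (a - b) ≤ c := by
    calc C * (ε : ℝ) ^ (a - b) ≤ (|C| + 1) * (c / (|C| + 1)) :=
          mul_le_mul ((le_abs_self C).trans (le_add_of_nonneg_right zero_le_one)) h1
            (Real.rpow_nonneg hε0.le _) (by positivity)
      _ = c := mul_div_cancel₀ _ (by positivity)
  calc C * (ε : ℝ) ^ a = C * (ε : ℝ) ^ (a - b) * (ε : ℝ) ^ b := by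
        rw [mul_assoc, ← Real.rpow_add hε0, sub_add_cancel]
    _ ≤ c * (ε : ℝ) ^ b := mul_le_mul_of_nonneg_right h2 (Real.rpow_nonneg hε0.le _)

lemma IsLittleOn.isBigOn {v : I → 𝔼 → 𝕜} {K : Set 𝔼} {p : ℕ} {a : ℝ} (h : IsLittleOn v K p a) :
    IsBigOn v K p a := ⟨1, h 1 one_pos⟩

lemma le_V {m p : ℕ} {u : moderate 𝕜 Ω} {a : ℝ}
    (h : IsLittleOn (extNet (u : I → smooth 𝕜 Ω)) (X.set m) p a) : (a : EReal) ≤ V X m p (mk u) :=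
  le_sSup ⟨a, rfl, u, rfl, h⟩

/-- In the definition of `V` one may use `O`- instead of `o`-estimates. -/
lemma le_V_of_isBigOn {m p : ℕ} {u : moderate 𝕜 Ω} {a : ℝ}
    (h : IsBigOn (extNet (u : I → smooth 𝕜 Ω)) (X.set m) p a) : (a : EReal) ≤ V X m p (mk u) := by
  by_contra! hlt
  obtain ⟨b, h1, h2⟩ := EReal.lt_iff_exists_real_btwn.1 hlt
  exact absurd (le_V (h.isLittleOn (EReal.coe_lt_coe_iff.1 h2))) (not_le.2 h1)

lemma V_ne_bot (m p : ℕ) (f : Gen 𝕜 Ω) : V X m p f ≠ ⊥ := by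
  obtain ⟨u, rfl⟩ := mk_surjective f
  obtain ⟨N, hN⟩ := u.2 _ (X.closure_subset m) (X.isCompact_closure m) p
  intro h
  have h1 := le_V_of_isBigOn (hN.subset (L := X.set m) subset_closure)
  rw [h, le_bot_iff] at h1
  exact EReal.coe_ne_bot _ h1

lemma V_zero (m p : ℕ) : V X m p (0 : Gen 𝕜 Ω) = ⊤ := by
  refine EReal.eq_top_iff_forall_lt _ |>.2 fun a => ?_
  have h : IsBigOn (extNet ((0 : moderate 𝕜 Ω) : I → smooth 𝕜 Ω)) (X.set m) p (a + 1) :=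
    (negligible 𝕜 Ω).zero_mem _ (X.closure_subset m) (X.isCompact_closure m) p
      ⌈a + 1⌉₊ |>.mono (Nat.le_ceil _) |>.subset subset_closure
  have h1 := le_V_of_isBigOn h
  rw [map_zero] at h1
  exact (EReal.coe_lt_coe_iff.2 (lt_add_one a)).trans_le h1

lemma Dmp_nonneg (m p : ℕ) (f g : Gen 𝕜 Ω) : 0 ≤ Dmp X m p f g := ENNReal.toReal_nonneg

lemma V_pos_of_Dmp_lt_one {m p : ℕ} {f g : Gen 𝕜 Ω} (h : Dmp X m p f g < 1) :
    0 < V X m p (f - g) := by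
  -- the case `V = ⊥`, where `toReal` takes a junk value, does not occur for moderate nets
  have h1 : EReal.exp (-V X m p (f - g)) ≠ ⊤ := by
    rw [Ne, EReal.exp_eq_top_iff, EReal.neg_eq_top_iff]
    exact V_ne_bot m p _
  have h2 : EReal.exp (-V X m p (f - g)) < 1 := by
    rw [← ENNReal.toReal_lt_toReal h1 ENNReal.one_ne_top, ENNReal.toReal_one]
    exact h
  rw [EReal.exp_lt_one_iff] at h2
  exact EReal.neg_lt_zero.1 h2

lemma Dmp_lt_one_of_D_lt_one {f g : Gen 𝕜 Ω} (h : D X f g < 1) (m : ℕ) : Dmp X m m f g < 1 := by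
  have hb : BddAbove (Set.range fun m : ℕ => 2 * Dmp X m m f g / (1 + Dmp X m m f g)) := by
    refine ⟨2, ?_⟩
    rintro _ ⟨m, rfl⟩
    have := Dmp_nonneg (X := X) m m f g
    change 2 * Dmp X m m f g / (1 + Dmp X m m f g) ≤ 2
    rw [div_le_iff₀ (by positivity)]
    linarith
  have h1 := (le_ciSup hb m).trans_lt h
  have := Dmp_nonneg (X := X) m m f g
  rw [div_lt_one (by positivity)] at h1
  linarith

lemma D_self (f : Gen 𝕜 Ω) : D X f f = 0 := by
  simp [D, Dmp, V_zero]

lemma V_le_V_diag_mul (h : smooth 𝕜 Ω) (m p : ℕ) (f : Gen 𝕜 Ω) :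
    V X m p f ≤ V X m p (diag 𝕜 Ω h * f) := by
  refine sSup_le ?_
  rintro _ ⟨a, rfl, u, rfl, hu⟩
  have h1 := isBigOn_mul (u := fun _ => h) (subset_closure.trans (X.closure_subset m))
    ((isBigOn_const h (X.closure_subset m) (X.isCompact_closure m) p).subset
      (subset_closure (s := X.set m))) hu.isBigOn
  rw [zero_add] at h1
  obtain ⟨c, hc, hc'⟩ : ∃ c : moderate 𝕜 Ω, mk c = diag 𝕜 Ω h ∧
      (c : I → smooth 𝕜 Ω) = fun _ => h := ⟨_, rfl, rfl⟩
  have h2 : mk (c * u) = diag 𝕜 Ω h * mk u := by rw [map_mul, hc]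
  rw [← h2]
  refine le_V_of_isBigOn ?_
  rw [← hc'] at h1
  exact h1

theorem gnorm_diag_mul (h : (smooth 𝕜 Ω)ˣ) (f : Gen 𝕜 Ω) :
    gnorm X (diag 𝕜 Ω h * f) = gnorm X f := by
  have hV : ∀ m, V X m m (diag 𝕜 Ω h * f) = V X m m f := by
    intro m
    refine le_antisymm ?_ (V_le_V_diag_mul _ _ _ _)
    -- the other inequality is the same one for `h⁻¹` and the element `h f`
    have h1 := V_le_V_diag_mul (X := X) (↑h⁻¹ : smooth 𝕜 Ω) m m (diag 𝕜 Ω h * f)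
    rwa [← mul_assoc, ← map_mul, Units.inv_mul, map_one, one_mul] at h1
  simp only [gnorm, D, Dmp, sub_zero, hV]

/-- Distinct distributions have distance at least one: this is the discreteness of the image of
the embedding. -/
theorem eq_of_D_embedding_lt_one {η : ℕ → 𝓓(Ω, ℝ)} {ρ : SchwartzMap 𝔼 ℝ}
    (hη : ∀ m, ∀ x ∈ X.set m, η m x = 1) (hρ : ∫ x, ρ x = 1) {S T : 𝓓'(Ω, 𝕜)}
    (h : D X (embedding hη ρ S) (embedding hη ρ T) < 1) : S = T := by
  rw [← sub_eq_zero]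
  obtain ⟨u, hu⟩ := mk_surjective (embedding hη ρ (S - T))
  refine ((mk_eq_embedding_iff hη).1 hu).eq_zero hη hρ fun m => ?_
  have h1 := V_pos_of_Dmp_lt_one (Dmp_lt_one_of_D_lt_one h m)
  rw [← map_sub, ← hu] at h1
  obtain ⟨_, ⟨a, rfl, v, hv, hv'⟩, ha⟩ := lt_sSup_iff.1 h1
  exact ⟨a, EReal.coe_pos.1 ha, v, hv, hv'⟩

end metric

end

end Colombeau

theorem mainTheorem2 {n : ℕ} {𝕜 : Type*} [RCLike 𝕜]
    (Ω : TopologicalSpace.Opens (EuclideanSpace ℝ (Fin n)))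
    (X : Colombeau.Exhaustion Ω) :
    (∀ ρ : SchwartzMap (EuclideanSpace ℝ (Fin n)) ℝ, Colombeau.IsMollifier ρ →
      ∃ ι : 𝓓'(Ω, 𝕜) →ₗ[𝕜] Colombeau.Gen 𝕜 Ω,
        (∀ ι' : 𝓓'(Ω, 𝕜) → Colombeau.Gen 𝕜 Ω,
          Colombeau.IsCanonicalEmbedding ρ ι' ↔ ι' = ⇑ι) ∧
        Function.Injective ι ∧
        @DiscreteTopology (Set.range ι)
          ((Colombeau.sharpTopology 𝕜 X).induced Subtype.val)) ∧
    (∀ (h : (Colombeau.smooth 𝕜 Ω)ˣ) (f : Colombeau.Gen 𝕜 Ω),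
      Colombeau.gnorm X (Colombeau.diag 𝕜 Ω h * f) = Colombeau.gnorm X f) := by
  refine ⟨fun ρ hρ => ?_, Colombeau.gnorm_diag_mul⟩
  obtain ⟨η, hη⟩ := X.exists_cutoffs
  have hη' : ∀ m, ∀ x ∈ X.set m, η m x = 1 := fun m x hx =>
    (hη m).self_of_nhdsSet x (subset_closure hx)
  refine ⟨Colombeau.embedding hη' ρ, Colombeau.isCanonicalEmbedding_iff hη hη', ?_, ?_⟩
  · intro S T hST
    refine Colombeau.eq_of_D_embedding_lt_one (X := X) hη' hρ.1 ?_
    rw [hST, Colombeau.D_self]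
    exact one_pos
  · let _ := Colombeau.sharpTopology 𝕜 X
    refine discreteTopology_iff_isOpen_singleton.2 ?_
    rintro ⟨_, T, rfl⟩
    refine isOpen_induced_iff.2 ⟨{g | Colombeau.D X g (Colombeau.embedding hη' ρ T) < 1},
      TopologicalSpace.isOpen_generateFrom_of_mem ⟨_, _, rfl⟩, ?_⟩
    ext ⟨_, S, rfl⟩
    simp only [Set.mem_preimage, Set.mem_ofPred_eq, Set.mem_singleton_iff]
    refine ⟨fun h => ?_, fun h => ?_⟩
    · rw [Colombeau.eq_of_D_embedding_lt_one hη' hρ.1 h]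
    · have h1 : Colombeau.embedding hη' ρ S = Colombeau.embedding hη' ρ T := congrArg Subtype.val h
      rw [h1, Colombeau.D_self]
      exact one_pos
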